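/- **Setting.** Let $1<\gamma_*<\gamma^*$ and let $\pi(dx)=e^{-x}\,dx$ on $[0,\infty)$. For $\gamma\in(\gamma_*,\gamma^*)$ let $P_\gamma$ be the independence Metropolis–Hastings kernel on $[0,\infty)$ with proposal density $\gamma e^{-\gamma y}$, $$P_\gamma(x,A)=\int_A a_\gamma(x,y)\,\gamma e^{-\gamma y}\,dy+\delta_x(A)\Big(1-\int_0^\infty a_\gamma(x,y)\,\gamma e^{-\gamma y}\,dy\Big),\qquad a_\gamma(x,y)=e^{(\gamma-1)(y-x)}\wedge 1 .$$ An adaptation plan $\mathcal Q$ is a sequence of probability kernels. The adaptive process $(\Gamma_t,X_t)_{t\ge0}$ starts from $(\Gamma_0,X_0)=(\gamma_0,0)$ with $\gamma_0\in(\gamma_*,\gamma^*)$; given the history up to time $t$, $\Gamma_{t+1}\in(\gamma_*,\gamma^*)$ is drawn from the kernel of $\mathcal Q$ at that history, and then $X_{t+1}\sim P_{\Gamma_{t+1}}(X_t,\cdot)$. Write $\mathcal A^{(t)}_{\mathcal Q}((\gamma_0,0),\cdot)$ for the law of $X_t$, and $\|\mu-\nu\|_{TV}$ for the infimum of $\xi(\{(x,y):x\ne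 y\})$ over couplings $\xi$ of $\mu$ and $\nu$. **Assumptions.** Let $\epsilon\in(0,1)$ with $\gamma^*<2-\epsilon$, let $\rho>0$, and let $G:\mathbb Z_{\ge0}\to(0,\infty)$ be strictly decreasing to $0$. Assume that almost surely adaptation is frozen beyond the level $\rho$, that is, for every $t\ge0$, $P_{\Gamma_{t+1}}(X_t,\cdot)=P_{\Gamma_t}(X_t,\cdot)$ whenever $X_t\ge\rho$, and that almost surely $|\Gamma_{t+1}-\Gamma_t|/G(t)\to0$ as $t\to\infty$. **Constants.** Put $$J=\frac2{\gamma_*^2}+\rho+\frac1{\gamma_*},\quad c=\frac{\gamma^*-1}{1-\epsilon},\quad K=\frac{\gamma^*}{\gamma_*-1+\epsilon},\quad \alpha=\frac{\gamma_*}{(2K)^{\frac{\gamma^*-1}{1-\epsilon}}},\quad r_1=(c+1)^{\frac{2-\epsilon-\gamma^*}{\gamma^*-1}},\quad R=(4K)^{\frac{1-\epsilon}{2-\epsilon-\gamma^*}},$$ $$C=1+2(r_1+1)(1+\epsilon^{-1})+(r_1+1)\{R+r_1(R+4K)\},\quad M_*=\gamma_*^{-\frac1{\gamma_*-1}}-\gamma_*^{-\frac{\gamma_*}{\gamma_*-1}},\quad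 c_*=\frac{\gamma^*}{\gamma_*-1}+\gamma^*-1,$$ and let $(1/G)^{-1}(y)$ be the least integer $n\ge0$ with $1/G(n)\ge y$. For $\delta\in(0,1)$ call an integer $s\ge0$ *admissible* if, with probability at least $1-\delta/2$, $$\|P_{\Gamma_{n+1}}(x,\cdot)-P_{\Gamma_n}(x,\cdot)\|_{TV}\le J\,G(n)\quad\text{for all }n\ge s\text{ and all }x\ge0 .$$ **Proposition 5.2.** For every $\delta\in(0,1)$ an admissible integer exists. For every admissible integer $s_\delta$ and every integer $t\ge0$, with $T_{\delta,t}=s_\delta+(1/G)^{-1}(Jt^2/\delta)$, $$\frac{M_*}{\left[c_*(T_{\delta,t}+t)+1\right]^{\frac1{\gamma_*-1}}}\ \le\ \big\|\mathcal A^{(T_{\delta,t}+t)}_{\mathcal Q}((\gamma_0,0),\cdot)-\pi\big\|_{TV}\ \le\ \frac{2(r_1+1)K\,T_{\delta,t}+C}{\left[1+c\,\dfrac{t}{-\log(1+ct)/\log(1-\alpha)+1}\right]^{\frac{1-\epsilon}{\gamma^*-1}}}+\delta .$$ -/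

import Mathlib

open MeasureTheory ProbabilityTheory Filter Topology
open scoped ENNReal NNReal

noncomputable section

/-! ### Total variation -/

/-- `ξ` is a coupling of `μ` and `ν`. -/
def IsCoupling {S : Type*} [MeasurableSpace S] (μ ν : Measure S) (ξ : Measure (S × S)) : Prop :=
  ξ.map Prod.fst = μ ∧ ξ.map Prod.snd = ν

/-- Total variation distance of two probability measures: the least probability of the
off-diagonal over all couplings. -/
def tvDist {S : Type*} [MeasurableSpace S] (μ ν : Measure S) : ℝ :=
  sInf {p : ℝ | ∃ ξ : Measure (S × S), IsCoupling μ ν ξ ∧ p = ξ.real {z | z.1 ≠ z.2}}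

/-! ### Adaptive processes -/

/-- An adaptation plan: for every time `t`, a probability kernel which draws the next tuning
parameter `Γ (t + 1)` from the whole history `(Γ 0, X 0), …, (Γ t, X t)`. -/
structure AdaptationPlan (Y S : Type*) [MeasurableSpace Y] [MeasurableSpace S] where
  /-- the kernel drawing `Γ (t + 1)` -/
  next : (t : ℕ) → Kernel ((i : Finset.Iic t) → (fun _ : ℕ => Y × S) i) Y
  markov : ∀ t, IsMarkovKernel (next t)

attribute [instance] AdaptationPlan.markov

section Adaptive

variable {Y S : Type*} [MeasurableSpace Y] [MeasurableSpace S]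

/-- The current state `X t` read off from a history up to time `t`. -/
def currentState (t : ℕ) (h : (i : Finset.Iic t) → (fun _ : ℕ => Y × S) i) : S :=
  (h ⟨t, Finset.mem_Iic.2 le_rfl⟩).2

theorem measurable_currentState (t : ℕ) : Measurable (currentState (Y := Y) (S := S) t) :=
  measurable_snd.comp (measurable_pi_apply _)

/-- One step of the adaptive process with Markov family `P` (`P (γ, x)` is the law of the next
state): first draw `Γ (t + 1)` with the plan, then `X (t + 1)` from `P (Γ (t + 1), X t)`. -/
def adaptiveStep (Q : AdaptationPlan Y S) (P : Kernel (Y × S) S) (t : ℕ) :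
    Kernel ((i : Finset.Iic t) → (fun _ : ℕ => Y × S) i) (Y × S) :=
  (Q.next t) ⊗ₖ (P.comap (fun p => (p.2, currentState t p.1))
    (measurable_snd.prodMk ((measurable_currentState t).comp measurable_fst)))

instance (Q : AdaptationPlan Y S) (P : Kernel (Y × S) S) [IsMarkovKernel P] (t : ℕ) :
    IsMarkovKernel (adaptiveStep Q P t) := by
  unfold adaptiveStep; infer_instance

/-- The law of the trajectory `(Γ t, X t)_{t ≥ 0}` of the adaptive process started from the fixed
pair `(Γ 0, X 0) = (γ₀, x₀)`. -/
def adaptiveLaw (Q : AdaptationPlan Y S) (P : Kernel (Y × S) S) [IsMarkovKernel P]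
    (γ₀ : Y) (x₀ : S) : Measure (ℕ → Y × S) :=
  Kernel.traj (X := fun _ => Y × S) (adaptiveStep Q P) 0 (fun _ => (γ₀, x₀))

/-- The law of `X t`. -/
def adaptiveMarginal (Q : AdaptationPlan Y S) (P : Kernel (Y × S) S) [IsMarkovKernel P]
    (γ₀ : Y) (x₀ : S) (t : ℕ) : Measure S :=
  (adaptiveLaw Q P γ₀ x₀).map (fun ω => (ω t).2)

/-- `s` is a diminishing time at level `η` for the rate `g`, under the trajectory law `μ`: with
probability at least `1 - η`, for all `n ≥ s` the kernels with parameters `Γ (n + 1)` and `Γ n` are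
uniformly within `g n` in total variation. -/
def IsDiminishingTime (P : Kernel (Y × S) S) (μ : Measure (ℕ → Y × S)) (g : ℕ → ℝ) (η : ℝ)
    (s : ℕ) : Prop :=
  μ.real {ω | ¬ ∀ n, s ≤ n → ∀ x : S, tvDist (P ((ω (n + 1)).1, x)) (P ((ω n).1, x)) ≤ g n} ≤ η

end Adaptive

/-- Generalized inverse of `n ↦ 1 / G n`: the least `n` with `1 / G n ≥ y`. -/
def invRecip (G : ℕ → ℝ) (y : ℝ) : ℕ := sInf {n : ℕ | y ≤ 1 / G n}

/-! ### The independence Metropolis–Hastings family on `[0, ∞)` -/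

/-- Lebesgue measure on `[0, ∞)`. -/
def lebNN : Measure ℝ≥0 := Measure.comap ((↑) : ℝ≥0 → ℝ) volume

/-- The target, the standard exponential law on `[0, ∞)`. -/
def expTarget : Measure ℝ≥0 :=
  lebNN.withDensity (fun x => ENNReal.ofReal (Real.exp (-(x : ℝ))))

/-- Acceptance probability of a move from `x` to `y` for the proposal of rate `γ`. -/
def imhAccept (γ : ℝ) (x y : ℝ≥0) : ℝ := min (Real.exp ((γ - 1) * ((y : ℝ) - x))) 1

/-- Acceptance probability times the density `γ exp (-γ y)` of the proposal. -/
def imhDensity (γ : ℝ) (x y : ℝ≥0) : ℝ := imhAccept γ x y * (γ * Real.exp (-γ * y))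

/-- Rejection probability at `x`. -/
def imhReject (γ : ℝ) (x : ℝ≥0) : ℝ := 1 - ∫ y, imhDensity γ x y ∂lebNN

/-- The one-step law from `x` of the sampler with tuning parameter `γ`. -/
def imhMeasure (γ : ℝ) (x : ℝ≥0) : Measure ℝ≥0 :=
  lebNN.withDensity (fun y => ENNReal.ofReal (imhDensity γ x y)) +
    ENNReal.ofReal (imhReject γ x) • Measure.dirac x

theorem measurableEmbedding_coeNN : MeasurableEmbedding ((↑) : ℝ≥0 → ℝ) :=
  MeasurableEmbedding.subtype_coe measurableSet_Ici

instance : SigmaFinite lebNN := by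
  have h : lebNN.map ((↑) : ℝ≥0 → ℝ) = volume.restrict (Set.range ((↑) : ℝ≥0 → ℝ)) :=
    measurableEmbedding_coeNN.map_comap volume
  refine ⟨⟨⟨fun n => (fun x : ℝ≥0 => (x : ℝ)) ⁻¹' Metric.closedBall 0 n, fun _ => trivial,
    fun n => ?_, ?_⟩⟩⟩
  · rw [← measurableEmbedding_coeNN.map_apply, h]
    exact (Measure.restrict_apply_le _ _).trans_lt measure_closedBall_lt_top
  · rw [← Set.preimage_iUnion, Metric.iUnion_closedBall_nat, Set.preimage_univ]

theorem lintegral_lebNN (f : ℝ → ℝ≥0∞) :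
    ∫⁻ y, f (y : ℝ) ∂lebNN = ∫⁻ y in Set.Ici (0 : ℝ), f y := by
  rw [← measurableEmbedding_coeNN.lintegral_map f, lebNN, measurableEmbedding_coeNN.map_comap]
  congr 2
  ext y
  exact ⟨fun ⟨z, hz⟩ => hz ▸ z.2, fun hy => ⟨⟨y, hy⟩, rfl⟩⟩

theorem measurable_imhDensity :
    Measurable (fun q : (ℝ × ℝ≥0) × ℝ≥0 => imhDensity q.1.1 q.1.2 q.2) := by
  unfold imhDensity imhAccept
  fun_prop

theorem measurable_imhReject : Measurable (fun q : ℝ × ℝ≥0 => imhReject q.1 q.2) := by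
  have h := measurable_imhDensity.stronglyMeasurable.integral_prod_right' (ν := lebNN)
  exact measurable_const.sub h.measurable

theorem measurable_imhMeasure : Measurable (fun q : ℝ × ℝ≥0 => imhMeasure q.1 q.2) := by
  refine Measure.measurable_of_measurable_coe _ fun s hs => ?_
  simp only [imhMeasure, Measure.add_apply, Measure.smul_apply, smul_eq_mul]
  refine Measurable.add ?_ (Measurable.mul measurable_imhReject.ennreal_ofReal ?_)
  · simp only [withDensity_apply _ hs]
    exact (measurable_imhDensity.ennreal_ofReal).lintegral_prod_right' (ν := lebNN.restrict s)
  · exact (Measure.measurable_coe hs).comp (Measure.measurable_dirac.comp measurable_snd)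

theorem imhDensity_nonneg {γ : ℝ} (hγ : 0 ≤ γ) (x y : ℝ≥0) : 0 ≤ imhDensity γ x y := by
  unfold imhDensity imhAccept
  positivity

theorem lintegral_imhDensity_le {γ : ℝ} (hγ : 0 < γ) (x : ℝ≥0) :
    ∫⁻ y, ENNReal.ofReal (imhDensity γ x y) ∂lebNN ≤ 1 := by
  have h1 : ∫⁻ y, ENNReal.ofReal (imhDensity γ x y) ∂lebNN ≤
      ∫⁻ y, ENNReal.ofReal (γ * Real.exp (-γ * (y : ℝ))) ∂lebNN := by
    refine lintegral_mono fun y => ENNReal.ofReal_le_ofReal ?_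
    have : imhAccept γ x y ≤ 1 := min_le_right _ _
    exact mul_le_of_le_one_left (by positivity) this
  refine h1.trans ?_
  rw [lintegral_lebNN (fun y => ENNReal.ofReal (γ * Real.exp (-γ * y))),
    ← restrict_Ioi_eq_restrict_Ici]
  have hi := integrableOn_exp_mul_Ioi (a := -γ) (by linarith) 0
  rw [← ofReal_integral_eq_lintegral_ofReal (hi.const_mul γ)
    (ae_of_all _ fun y => by positivity), integral_const_mul,
    integral_exp_mul_Ioi (by linarith)]
  simp [hγ.ne']

theorem isProbabilityMeasure_imhMeasure {γ : ℝ} (hγ : 0 < γ) (x : ℝ≥0) :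
    IsProbabilityMeasure (imhMeasure γ x) := by
  have hm : Measurable (imhDensity γ x) :=
    measurable_imhDensity.comp (measurable_prodMk_left (x := (γ, x)))
  have hle := lintegral_imhDensity_le hγ x
  have hint : ∫ y, imhDensity γ x y ∂lebNN =
      (∫⁻ y, ENNReal.ofReal (imhDensity γ x y) ∂lebNN).toReal :=
    integral_eq_lintegral_of_nonneg_ae (ae_of_all _ fun y => imhDensity_nonneg hγ.le x y)
      hm.aestronglyMeasurable
  have hne : ∫⁻ y, ENNReal.ofReal (imhDensity γ x y) ∂lebNN ≠ ∞ :=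
    (hle.trans_lt ENNReal.one_lt_top).ne
  constructor
  simp only [imhMeasure, Measure.add_apply, Measure.smul_apply, smul_eq_mul, measure_univ, mul_one,
    withDensity_apply _ MeasurableSet.univ, Measure.restrict_univ, imhReject, hint]
  rw [ENNReal.ofReal_sub _ ENNReal.toReal_nonneg, ENNReal.ofReal_toReal hne, ENNReal.ofReal_one,
    add_tsub_cancel_of_le hle]

/-- The one-step laws as a kernel in the pair `(γ, x)`, for all real `γ`. -/
def imhBase : Kernel (ℝ × ℝ≥0) ℝ≥0 where
  toFun q := imhMeasure q.1 q.2
  measurable' := measurable_imhMeasure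

/-- The independence Metropolis–Hastings family with parameter set `(γl, γu)`, `1 < γl`, as a kernel
`(γ, x) ↦ P_γ(x, ·)`. The argument `_h` serves to make the kernel a Markov kernel. -/
def imhKernel (γl γu : ℝ) (_h : 1 < γl) : Kernel (Set.Ioo γl γu × ℝ≥0) ℝ≥0 :=
  imhBase.comap (fun p => ((p.1 : ℝ), p.2))
    ((measurable_subtype_coe.comp measurable_fst).prodMk measurable_snd)

theorem imhKernel_apply (γl γu : ℝ) (h : 1 < γl) (γ : Set.Ioo γl γu) (x : ℝ≥0) :
    imhKernel γl γu h (γ, x) = imhMeasure γ x := rfl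

instance (γl γu : ℝ) (h : 1 < γl) : IsMarkovKernel (imhKernel γl γu h) :=
  ⟨fun p => isProbabilityMeasure_imhMeasure (lt_trans (by linarith) p.1.2.1) p.2⟩

/-! ### The explicit bounds -/

/-- The lower bound `M_* / (c_* n + 1) ^ (1 / (γ_* - 1))` at time `n`. -/
def imhLower (γl γu : ℝ) (n : ℕ) : ℝ :=
  let M := γl ^ (-1 / (γl - 1)) - γl ^ (-γl / (γl - 1))
  let c := γu / (γl - 1) + γu - 1
  M / (c * n + 1) ^ (1 / (γl - 1))

/-- The Lipschitz-type constant `J`, for the freezing level `ρ`. -/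
def imhJ (γl ρ : ℝ) : ℝ := 2 / γl ^ 2 + ρ + 1 / γl

/-- The upper bound, without the additive term `δ`. Here `r₁` stands for `r(1)`. -/
def imhUpper (γl γu ε : ℝ) (T t : ℕ) : ℝ :=
  let c := (γu - 1) / (1 - ε)
  let K := γu / (γl - 1 + ε)
  let α := γl / (2 * K) ^ ((γu - 1) / (1 - ε))
  let r₁ := (c + 1) ^ ((2 - ε - γu) / (γu - 1))
  let R := (4 * K) ^ ((1 - ε) / (2 - ε - γu))
  let C := 1 + 2 * (r₁ + 1) * (1 + ε⁻¹) + (r₁ + 1) * (R + r₁ * (R + 4 * K))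
  (2 * (r₁ + 1) * K * T + C) /
    (1 + c * (t / (-Real.log (1 + c * t) / Real.log (1 - α) + 1))) ^ ((1 - ε) / (γu - 1))

end

/-! Upper bound. Freeze the parameter at its value `Γ (T + 1)`. On the admissible event the kernel
used `k` steps later differs from the frozen one by at most `k * g` in total variation, so `t` steps
cost at most `g * t ^ 2 / 2`. The time `T` is chosen to make this at most `δ / 2`, and the
exceptional event costs another `δ / 2` (`adaptiveMarginal_le_iterMean`). What remains is the
convergence of a non-adaptive sampler started from the law of `X T`.

For a fixed parameter the acceptance probability decreases in the current state, so two copies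
driven by the same proposal and the same uniform variable meet as soon as the upper one accepts.
Before that the upper copy has not moved. Hence the coupling error after `t` steps is the `t`-th
power of the rejection probability at the larger starting point (`iterMean_imhKernel_le`). Against
the stationary start this leaves the rejection powers at `X T` and under the target. The power at
`x` is at most a polynomial rate in `t` times `V x = exp ((1 - ε) x)` (`imhReject_pow_le`). The mean
of `V (X T)` is at most `1 + K * T`, because each step adds at most `K`
(`lintegral_exp_imhMeasure_le`), and the target integrates `V` to `1 / ε`. The resulting bound is
sharper than `imhUpper`, whose further constants only enlarge it (`le_imhUpper`).

Lower bound. The chain can enter `(b, ∞)` only through a proposal, so by time `n` it is there with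
probability at most `n * exp (-γl * b)`, against `exp (-b)` for the target. Optimising over `b`
gives `imhLower`.

Admissible times exist because the kernels are Lipschitz in the parameter uniformly in the state
(`tvDist_imhMeasure_le`), so increments of order `o(G)` are eventually below any fixed multiple of
`G`. -/

/-! ### Total variation through measurable sets and functions -/

section TotalVariation

variable {S : Type*} [MeasurableSpace S]

/-- Under any coupling, `f z.1 ≤ f z.2` plus the indicator of the off-diagonal. Integrate and take a
coupling within `r` of the infimum, which need not be attained. -/
theorem lintegral_le_lintegral_add_tvDist (μ ν : Measure S) [IsProbabilityMeasure μ]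
    [IsProbabilityMeasure ν] {f : S → ℝ≥0∞} (hf : Measurable f) (hf1 : ∀ x, f x ≤ 1) :
    ∫⁻ x, f x ∂μ ≤ ∫⁻ x, f x ∂ν + ENNReal.ofReal (tvDist μ ν) := by
  refine ENNReal.le_of_forall_pos_le_add fun r hr _ => ?_
  have hne : {p : ℝ | ∃ ξ : Measure (S × S), IsCoupling μ ν ξ ∧
      p = ξ.real {z | z.1 ≠ z.2}}.Nonempty :=
    ⟨_, μ.prod ν, ⟨by simp, by simp⟩, rfl⟩
  obtain ⟨p, ⟨ξ, ⟨h1, h2⟩, rfl⟩, hlt⟩ := exists_lt_of_csInf_lt hne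
    (show sInf _ < tvDist μ ν + r from lt_add_of_pos_right _ (by exact_mod_cast hr))
  have hξ : IsFiniteMeasure ξ := by
    refine ⟨?_⟩
    have : ξ.map Prod.fst Set.univ = 1 := by rw [h1]; exact measure_univ
    rw [Measure.map_apply measurable_fst MeasurableSet.univ] at this
    simp [Set.preimage_univ ▸ this]
  have key : ∫⁻ z, f z.1 ∂ξ ≤ ∫⁻ z, f z.2 ∂ξ + ξ {z | z.1 ≠ z.2} := by
    calc ∫⁻ z, f z.1 ∂ξ
        ≤ ∫⁻ z, (f z.2 + Set.indicator {z : S × S | z.1 ≠ z.2} (fun _ => 1) z) ∂ξ := by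
          refine lintegral_mono fun z => ?_
          by_cases hz : z.1 = z.2
          · simp [hz]
          · simpa [Set.indicator_of_mem (show z ∈ {z : S × S | z.1 ≠ z.2} from hz)] using
              (hf1 z.1).trans le_add_self
      _ ≤ _ := by
          rw [lintegral_add_left (f := fun z : S × S => f z.2) (hf.comp measurable_snd)]
          gcongr
          simpa using lintegral_indicator_const_le {z : S × S | z.1 ≠ z.2} (1 : ℝ≥0∞) (μ := ξ)
  calc ∫⁻ x, f x ∂μ = ∫⁻ z, f z.1 ∂ξ := by rw [← h1, lintegral_map hf measurable_fst]
    _ ≤ ∫⁻ z, f z.2 ∂ξ + ξ {z | z.1 ≠ z.2} := key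
    _ = ∫⁻ x, f x ∂ν + ENNReal.ofReal (ξ.real {z | z.1 ≠ z.2}) := by
        rw [← h2, lintegral_map hf measurable_snd, ofReal_measureReal]
    _ ≤ ∫⁻ x, f x ∂ν + ENNReal.ofReal (tvDist μ ν + r) := by gcongr
    _ ≤ ∫⁻ x, f x ∂ν + (ENNReal.ofReal (tvDist μ ν) + r) := by
        gcongr
        exact ENNReal.ofReal_add_le.trans (by simp)
    _ = _ := (add_assoc _ _ _).symm

theorem measure_le_add_tvDist (μ ν : Measure S) [IsProbabilityMeasure μ]
    [IsProbabilityMeasure ν] {s : Set S} (hs : MeasurableSet s) :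
    μ s ≤ ν s + ENNReal.ofReal (tvDist μ ν) := by
  have := lintegral_le_lintegral_add_tvDist μ ν (f := s.indicator 1)
    (measurable_one.indicator hs) (fun x => Set.indicator_le_self' (fun _ _ => zero_le) x)
  simpa [lintegral_indicator_one hs] using this

theorem tvDist_comm (μ ν : Measure S) (hd : MeasurableSet {z : S × S | z.1 ≠ z.2}) :
    tvDist μ ν = tvDist ν μ := by
  have key : ∀ (μ ν : Measure S) (p : ℝ),
      (∃ ξ : Measure (S × S), IsCoupling μ ν ξ ∧ p = ξ.real {z | z.1 ≠ z.2}) →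
      ∃ ξ : Measure (S × S), IsCoupling ν μ ξ ∧ p = ξ.real {z | z.1 ≠ z.2} := by
    rintro μ ν p ⟨ξ, ⟨h1, h2⟩, rfl⟩
    refine ⟨ξ.map Prod.swap, ⟨?_, ?_⟩, ?_⟩
    · rw [Measure.map_map measurable_fst measurable_swap]; exact h2
    · rw [Measure.map_map measurable_snd measurable_swap]; exact h1
    · rw [measureReal_def, measureReal_def, Measure.map_apply measurable_swap hd]
      congr 2
      ext z
      exact ne_comm
  unfold tvDist
  congr 1
  ext p
  exact ⟨key μ ν p, key ν μ p⟩

/-- Maximal coupling. The common part `m` of the two measures sits on the diagonal, and the excesses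
`a` and `b`, of equal mass, are coupled as a normalised product. The off-diagonal then has mass at
most that of `a`, which is `μ s - ν s` for the Hahn set `s`. -/
theorem tvDist_le_of_forall_measure_le (μ ν : Measure S) [IsProbabilityMeasure μ]
    [IsProbabilityMeasure ν] (hd : MeasurableSet {z : S × S | z.1 ≠ z.2}) {d : ℝ} (hd0 : 0 ≤ d)
    (h : ∀ s, MeasurableSet s → μ s ≤ ν s + ENNReal.ofReal d) : tvDist μ ν ≤ d := by
  obtain ⟨s, hs, hνμ, hμν⟩ := hahn_decomposition μ ν
  have hle1 : ν.restrict s ≤ μ.restrict s := Measure.le_iff.2 fun u hu => by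
    rw [Measure.restrict_apply hu, Measure.restrict_apply hu]
    exact hνμ _ (hu.inter hs) Set.inter_subset_right
  have hle2 : μ.restrict sᶜ ≤ ν.restrict sᶜ := Measure.le_iff.2 fun u hu => by
    rw [Measure.restrict_apply hu, Measure.restrict_apply hu]
    exact hμν _ (hu.inter hs.compl) Set.inter_subset_right
  set a := μ.restrict s - ν.restrict s with ha
  set b := ν.restrict sᶜ - μ.restrict sᶜ with hb
  set m := ν.restrict s + μ.restrict sᶜ with hm
  have ham : a + m = μ := by
    rw [hm, ← add_assoc, ha, Measure.sub_add_cancel_of_le hle1, Measure.restrict_add_restrict_compl hs]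
  have hbm : b + m = ν := by
    rw [hm, add_comm (ν.restrict s), ← add_assoc, hb, Measure.sub_add_cancel_of_le hle2, add_comm,
      Measure.restrict_add_restrict_compl hs]
  have : IsFiniteMeasure m := by rw [hm]; infer_instance
  have hab : a Set.univ = b Set.univ := by
    have h1 : a Set.univ + m Set.univ = 1 := by rw [← Measure.add_apply, ham, measure_univ]
    have h2 : b Set.univ + m Set.univ = 1 := by rw [← Measure.add_apply, hbm, measure_univ]
    exact (ENNReal.add_left_inj (measure_ne_top m _)).1 (h1.trans h2.symm)
  have had : a Set.univ ≤ ENNReal.ofReal d := by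
    have h3 : a Set.univ + ν s = μ s := by
      have := congrArg (fun q : Measure S => q Set.univ) (Measure.sub_add_cancel_of_le hle1)
      simpa using this
    have h4 := h s hs
    rw [← h3, add_comm (ν s)] at h4
    exact (ENNReal.add_le_add_iff_right (measure_ne_top ν s)).1 h4
  have : IsFiniteMeasure a := ⟨had.trans_lt ENNReal.ofReal_lt_top⟩
  have : IsFiniteMeasure b := ⟨(hab ▸ had).trans_lt ENNReal.ofReal_lt_top⟩
  have hdiag : Measurable fun x : S => (x, x) := measurable_id.prodMk measurable_id
  -- When the excess has mass zero the factor `(a Set.univ)⁻¹` is `∞`, but it multiplies the zero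
  -- measure, so normalisation is still harmless.
  have hscale : ∀ q : Measure S, q Set.univ = a Set.univ →
      (a Set.univ)⁻¹ • (a Set.univ • q) = q := by
    intro q hq
    by_cases h0 : a Set.univ = 0
    · rw [h0] at hq
      rw [Measure.measure_univ_eq_zero.1 hq]; simp
    · rw [smul_smul, ENNReal.inv_mul_cancel h0 (measure_ne_top a _), one_smul]
  set ξ := m.map (fun x => (x, x)) + (a Set.univ)⁻¹ • a.prod b with hξ
  have hc : IsCoupling μ ν ξ := by
    constructor
    · rw [hξ, Measure.map_add _ _ measurable_fst, Measure.map_smul,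
        Measure.map_map measurable_fst hdiag, Measure.map_fst_prod, ← hab, hscale a rfl]
      simp only [Function.comp_def]
      rw [Measure.map_id', add_comm, ham]
    · rw [hξ, Measure.map_add _ _ measurable_snd, Measure.map_smul,
        Measure.map_map measurable_snd hdiag, Measure.map_snd_prod, hscale b hab.symm]
      simp only [Function.comp_def]
      rw [Measure.map_id', add_comm, hbm]
  have hoff : ξ {z | z.1 ≠ z.2} ≤ ENNReal.ofReal d := by
    rw [hξ, Measure.add_apply, Measure.map_apply hdiag hd]
    simp only [Set.preimage_ofPred_eq, ne_eq, not_true_eq_false, Set.ofPred_false, measure_empty,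
      zero_add, Measure.smul_apply, smul_eq_mul]
    calc (a Set.univ)⁻¹ * a.prod b _ ≤ (a Set.univ)⁻¹ * a.prod b Set.univ := by
          gcongr; exact Set.subset_univ _
      _ = ((a Set.univ)⁻¹ * a Set.univ) * a Set.univ := by
          rw [← Set.univ_prod_univ, Measure.prod_prod, ← hab, mul_assoc]
      _ ≤ 1 * a Set.univ := by gcongr; exact ENNReal.inv_mul_le_one _
      _ ≤ _ := by rw [one_mul]; exact had
  have hbdd : BddBelow {p : ℝ | ∃ ξ : Measure (S × S), IsCoupling μ ν ξ ∧
      p = ξ.real {z | z.1 ≠ z.2}} := by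
    refine ⟨0, ?_⟩
    rintro _ ⟨ξ, -, rfl⟩
    exact measureReal_nonneg
  exact (csInf_le hbdd ⟨ξ, hc, rfl⟩).trans (ENNReal.toReal_le_of_le_ofReal hd0 hoff)

end TotalVariation

/-! ### Adaptive processes: conditioning, additive drift, comparison with a frozen chain -/

section AdaptiveProcess

variable {Y S : Type*} [MeasurableSpace Y] [MeasurableSpace S]

instance (Q : AdaptationPlan Y S) (P : Kernel (Y × S) S) [IsMarkovKernel P] (γ₀ : Y) (x₀ : S) :
    IsProbabilityMeasure (adaptiveLaw Q P γ₀ x₀) := by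
  unfold adaptiveLaw; infer_instance

/-- Extend a history up to time `n` by the parameter of time `n + 1`. -/
def extendHistory (n : ℕ) (q : ((i : Finset.Iic n) → (fun _ : ℕ => Y × S) i) × Y) : ℕ → Y × S :=
  fun i => if hi : i ≤ n then q.1 ⟨i, Finset.mem_Iic.2 hi⟩ else (q.2, currentState n q.1)

theorem measurable_extendHistory (n : ℕ) : Measurable (extendHistory (Y := Y) (S := S) n) := by
  refine measurable_pi_lambda _ fun i => ?_
  unfold extendHistory
  by_cases hi : i ≤ n
  · simp only [hi, dif_pos]
    exact (measurable_pi_apply _).comp measurable_fst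
  · simp only [hi, dif_neg, not_false_eq_true]
    exact measurable_snd.prodMk ((measurable_currentState n).comp measurable_fst)

theorem lintegral_adaptiveLaw_history (Q : AdaptationPlan Y S) (P : Kernel (Y × S) S)
    [IsMarkovKernel P] (γ₀ : Y) (x₀ : S) (n : ℕ)
    {F : ((i : Finset.Iic n) → (fun _ : ℕ => Y × S) i) × (Y × S) → ℝ≥0∞} (hF : Measurable F) :
    ∫⁻ ω, F (Preorder.frestrictLe n ω, ω (n + 1)) ∂adaptiveLaw Q P γ₀ x₀ =
      ∫⁻ ω, ∫⁻ γ, ∫⁻ x, F (Preorder.frestrictLe n ω, (γ, x)) ∂P (γ, (ω n).2)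
        ∂Q.next n (Preorder.frestrictLe n ω) ∂adaptiveLaw Q P γ₀ x₀ := by
  have h := Kernel.partialTraj_compProd_eq_map_traj (X := fun _ => Y × S)
    (κ := adaptiveStep Q P) (Nat.zero_le n) (x₀ := fun _ => (γ₀, x₀))
  have hm : Measurable fun ω : ℕ → Y × S => (Preorder.frestrictLe (π := fun _ => Y × S) n ω, ω (n + 1)) :=
    (Preorder.measurable_frestrictLe n).prodMk (measurable_pi_apply _)
  unfold adaptiveLaw
  rw [← lintegral_map hF hm, ← h, Measure.lintegral_compProd hF,
    ← Kernel.traj_map_frestrictLe_apply, lintegral_map hF.lintegral_kernel_prod_right'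
      (Preorder.measurable_frestrictLe n)]
  refine lintegral_congr fun ω => ?_
  unfold adaptiveStep
  rw [Kernel.lintegral_compProd (f := fun b => F (Preorder.frestrictLe n ω, b)) _ _ _
    (hF.comp measurable_prodMk_left)]
  rfl

/-- Given the past and the next parameter, the next state is drawn from the Markov family. -/
theorem lintegral_adaptiveLaw_succ (Q : AdaptationPlan Y S) (P : Kernel (Y × S) S)
    [IsMarkovKernel P] (γ₀ : Y) (x₀ : S) (n : ℕ) {F : (ℕ → Y × S) × S → ℝ≥0∞} (hF : Measurable F)
    (hdep : ∀ ω ω' x, (∀ i ≤ n, ω i = ω' i) → (ω (n + 1)).1 = (ω' (n + 1)).1 →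
      F (ω, x) = F (ω', x)) :
    ∫⁻ ω, F (ω, (ω (n + 1)).2) ∂adaptiveLaw Q P γ₀ x₀ =
      ∫⁻ ω, ∫⁻ x, F (ω, x) ∂P ((ω (n + 1)).1, (ω n).2) ∂adaptiveLaw Q P γ₀ x₀ := by
  -- `extendHistory` fills the state at time `n + 1` and all later coordinates with placeholders. By
  -- `hdep` the function `F` does not see them.
  have hext : ∀ ω x, F (ω, x) =
      F (extendHistory n (Preorder.frestrictLe n ω, (ω (n + 1)).1), x) := fun ω x =>
    hdep _ _ _ (fun i hi => by simp [extendHistory, hi]) (by simp [extendHistory])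
  set A : ((i : Finset.Iic n) → (fun _ : ℕ => Y × S) i) × (Y × S) → ℝ≥0∞ :=
    fun q => F (extendHistory n (q.1, q.2.1), q.2.2) with hA
  have hAm : Measurable A := hF.comp (((measurable_extendHistory n).comp
    (measurable_fst.prodMk (measurable_fst.comp measurable_snd))).prodMk
    (measurable_snd.comp measurable_snd))
  set B : ((i : Finset.Iic n) → (fun _ : ℕ => Y × S) i) × (Y × S) → ℝ≥0∞ :=
    fun q => ∫⁻ x, A (q.1, (q.2.1, x)) ∂P (q.2.1, currentState n q.1) with hB
  have hBm : Measurable B := by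
    have h1 : Measurable fun q : (((i : Finset.Iic n) → (fun _ : ℕ => Y × S) i) × (Y × S)) =>
        (q.2.1, currentState n q.1) :=
      (measurable_fst.comp measurable_snd).prodMk ((measurable_currentState n).comp measurable_fst)
    have h2 : Measurable fun r : (((i : Finset.Iic n) → (fun _ : ℕ => Y × S) i) × (Y × S)) × S =>
        A (r.1.1, (r.1.2.1, r.2)) := hAm.comp (by fun_prop)
    exact h2.lintegral_kernel_prod_right' (κ := P.comap _ h1)
  calc ∫⁻ ω, F (ω, (ω (n + 1)).2) ∂adaptiveLaw Q P γ₀ x₀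
      = ∫⁻ ω, A (Preorder.frestrictLe n ω, ω (n + 1)) ∂adaptiveLaw Q P γ₀ x₀ :=
        lintegral_congr fun ω => hext _ _
    _ = ∫⁻ ω, B (Preorder.frestrictLe n ω, ω (n + 1)) ∂adaptiveLaw Q P γ₀ x₀ := by
        -- `B` is already averaged over the new state, so disintegrating it once more integrates a
        -- constant against a probability measure and gives the same value as `A`.
        rw [lintegral_adaptiveLaw_history Q P γ₀ x₀ n hAm,
          lintegral_adaptiveLaw_history Q P γ₀ x₀ n hBm]
        refine lintegral_congr fun ω => lintegral_congr fun γ => ?_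
        simp only [hB]
        rw [lintegral_const, measure_univ, mul_one]
        rfl
    _ = _ := by
        refine lintegral_congr fun ω => ?_
        simp only [hB, hA]
        refine (lintegral_congr fun x => ?_).symm
        exact hext _ _

theorem lintegral_adaptiveLaw_zero (Q : AdaptationPlan Y S) (P : Kernel (Y × S) S)
    [IsMarkovKernel P] (γ₀ : Y) (x₀ : S) {f : S → ℝ≥0∞} (hf : Measurable f) :
    ∫⁻ ω, f (ω 0).2 ∂adaptiveLaw Q P γ₀ x₀ = f x₀ := by
  have h := Kernel.traj_map_frestrictLe_apply (X := fun _ => Y × S)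
    (κ := adaptiveStep Q P) 0 0 (fun _ => (γ₀, x₀))
  rw [Kernel.partialTraj_self, Kernel.id_apply] at h
  have hg : Measurable fun h : (i : Finset.Iic 0) → (fun _ : ℕ => Y × S) i =>
      f (currentState 0 h) := hf.comp (measurable_currentState 0)
  have := lintegral_map hg (Preorder.measurable_frestrictLe (X := fun _ => Y × S) 0)
    (μ := adaptiveLaw Q P γ₀ x₀)
  unfold adaptiveLaw at this ⊢
  rw [h, lintegral_dirac' _ hg] at this
  exact this.symm

/-- A function which one step increases by at most `K` in the mean grows at most linearly. -/
theorem lintegral_adaptiveLaw_le_of_drift (Q : AdaptationPlan Y S) (P : Kernel (Y × S) S)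
    [IsMarkovKernel P] (γ₀ : Y) (x₀ : S) {V : S → ℝ≥0∞} (hV : Measurable V) {K : ℝ≥0∞}
    (hdrift : ∀ γ x, ∫⁻ y, V y ∂P (γ, x) ≤ V x + K) (n : ℕ) :
    ∫⁻ ω, V (ω n).2 ∂adaptiveLaw Q P γ₀ x₀ ≤ V x₀ + n * K := by
  induction n with
  | zero => simp [lintegral_adaptiveLaw_zero Q P γ₀ x₀ hV]
  | succ n ih =>
    rw [lintegral_adaptiveLaw_succ Q P γ₀ x₀ n (F := fun q => V q.2) (hV.comp measurable_snd)
      (fun _ _ _ _ _ => rfl)]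
    calc ∫⁻ ω, ∫⁻ x, V x ∂P ((ω (n + 1)).1, (ω n).2) ∂adaptiveLaw Q P γ₀ x₀
        ≤ ∫⁻ ω, (V (ω n).2 + K) ∂adaptiveLaw Q P γ₀ x₀ := lintegral_mono fun ω => hdrift _ _
      _ = ∫⁻ ω, V (ω n).2 ∂adaptiveLaw Q P γ₀ x₀ + K := by
          rw [lintegral_add_right _ measurable_const]; simp
      _ ≤ V x₀ + n * K + K := by gcongr
      _ = _ := by push_cast; ring

/-- If `Z k` increases in the mean by at most `e k` on `E k`, the mean of `Z k` on the intersection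
of the `E j`, `j < k`, is controlled. -/
theorem lintegral_adaptiveLaw_telescope (Q : AdaptationPlan Y S) (P : Kernel (Y × S) S)
    [IsMarkovKernel P] (γ₀ : Y) (x₀ : S) (T : ℕ) {Z : ℕ → Y × S → ℝ≥0∞}
    (hZ : ∀ k, Measurable (Z k)) (e : ℕ → ℝ≥0∞) (k : ℕ) :
    MeasurableSet {ω : ℕ → Y × S | ∀ j < k,
      ∫⁻ y, Z (j + 1) ((ω (T + 1)).1, y) ∂P ((ω (T + j + 1)).1, (ω (T + j)).2) ≤
        Z j ((ω (T + 1)).1, (ω (T + j)).2) + e j} ∧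
    ∫⁻ ω in {ω : ℕ → Y × S | ∀ j < k,
      ∫⁻ y, Z (j + 1) ((ω (T + 1)).1, y) ∂P ((ω (T + j + 1)).1, (ω (T + j)).2) ≤
        Z j ((ω (T + 1)).1, (ω (T + j)).2) + e j},
      Z k ((ω (T + 1)).1, (ω (T + k)).2) ∂adaptiveLaw Q P γ₀ x₀ ≤
    ∫⁻ ω, Z 0 ((ω (T + 1)).1, (ω T).2) ∂adaptiveLaw Q P γ₀ x₀ + ∑ j ∈ Finset.range k, e j := by
  set A : ℕ → Set (ℕ → Y × S) := fun k => {ω | ∀ j < k,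
      ∫⁻ y, Z (j + 1) ((ω (T + 1)).1, y) ∂P ((ω (T + j + 1)).1, (ω (T + j)).2) ≤
        Z j ((ω (T + 1)).1, (ω (T + j)).2) + e j} with hA
  have hAm : ∀ k, MeasurableSet (A k) := by
    intro k
    have : A k = ⋂ j, ⋂ (_ : j < k), {ω |
      ∫⁻ y, Z (j + 1) ((ω (T + 1)).1, y) ∂P ((ω (T + j + 1)).1, (ω (T + j)).2) ≤
        Z j ((ω (T + 1)).1, (ω (T + j)).2) + e j} := by ext; simp [hA]
    rw [this]
    refine MeasurableSet.iInter fun j => MeasurableSet.iInter fun _ => ?_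
    refine measurableSet_le ?_ (by fun_prop)
    have h1 : Measurable fun ω : ℕ → Y × S => ((ω (T + j + 1)).1, (ω (T + j)).2) := by fun_prop
    have h2 : Measurable fun r : (ℕ → Y × S) × S => Z (j + 1) ((r.1 (T + 1)).1, r.2) := by fun_prop
    exact h2.lintegral_kernel_prod_right' (κ := P.comap _ h1)
  refine ⟨hAm k, ?_⟩
  change ∫⁻ ω in A k, _ ∂_ ≤ _
  induction k with
  | zero => simp [hA]
  | succ k ih =>
    have hdep : ∀ ω ω' : ℕ → Y × S, (∀ i ≤ T + k, ω i = ω' i) →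
        (ω (T + k + 1)).1 = (ω' (T + k + 1)).1 → ∀ i ≤ T + k + 1, (ω i).1 = (ω' i).1 := by
      intro ω ω' h h' i hi
      rcases hi.lt_or_eq with hi | rfl
      · rw [h i (by omega)]
      · exact h'
    have hF : Measurable fun q : (ℕ → Y × S) × S =>
        (A (k + 1)).indicator (fun ω => Z (k + 1) ((ω (T + 1)).1, q.2)) q.1 := by
      have : (fun q : (ℕ → Y × S) × S =>
          (A (k + 1)).indicator (fun ω => Z (k + 1) ((ω (T + 1)).1, q.2)) q.1) =
          (Prod.fst ⁻¹' A (k + 1)).indicator (fun q => Z (k + 1) ((q.1 (T + 1)).1, q.2)) := by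
        ext q; simp [Set.indicator]
      rw [this]
      exact Measurable.indicator (by fun_prop) (measurable_fst (hAm _))
    -- The event `A (k + 1)` involves states up to time `T + k` and parameters up to `T + k + 1`
    -- only. It is thus decided before the state at time `T + k + 1` is drawn, and conditioning may
    -- pass under its indicator.
    have hstep := lintegral_adaptiveLaw_succ Q P γ₀ x₀ (T + k) hF (by
      intro ω ω' x h h'
      have h1 := hdep ω ω' h h'
      have hmem : ω ∈ A (k + 1) ↔ ω' ∈ A (k + 1) := by
        simp only [hA, Set.mem_ofPred_eq]
        refine forall₂_congr fun j hj => ?_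
        rw [h1 (T + 1) (by omega), h1 (T + j + 1) (by omega), h (T + j) (by omega)]
      simp only [Set.indicator, hmem, h1 (T + 1) (by omega)])
    rw [← lintegral_indicator (hAm _)]
    refine (le_of_eq hstep).trans ?_
    calc ∫⁻ ω, ∫⁻ x, (A (k + 1)).indicator (fun ω => Z (k + 1) ((ω (T + 1)).1, x)) ω
          ∂P ((ω (T + k + 1)).1, (ω (T + k)).2) ∂adaptiveLaw Q P γ₀ x₀
        ≤ ∫⁻ ω, ((A k).indicator (fun ω => Z k ((ω (T + 1)).1, (ω (T + k)).2)) ω + e k)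
          ∂adaptiveLaw Q P γ₀ x₀ := by
          refine lintegral_mono fun ω => ?_
          by_cases hω : ω ∈ A (k + 1)
          · have hω' : ω ∈ A k := fun j hj => hω j (by omega)
            simpa only [Set.indicator_of_mem hω, Set.indicator_of_mem hω'] using
              hω k (Nat.lt_succ_self k)
          · simp [Set.indicator_of_notMem hω]
      _ = ∫⁻ ω in A k, Z k ((ω (T + 1)).1, (ω (T + k)).2) ∂adaptiveLaw Q P γ₀ x₀ + e k := by
          rw [lintegral_add_right _ measurable_const, lintegral_indicator (hAm k)]; simp
      _ ≤ _ := by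
          rw [Finset.sum_range_succ, ← add_assoc]
          gcongr

/-- The mean of `f` after `n` steps of the chain with a fixed parameter. -/
noncomputable def iterMean (P : Kernel (Y × S) S) (f : S → ℝ≥0∞) : ℕ → Y × S → ℝ≥0∞
  | 0 => fun p => f p.2
  | n + 1 => fun p => ∫⁻ y, iterMean P f n (p.1, y) ∂P p

theorem measurable_iterMean (P : Kernel (Y × S) S) [IsMarkovKernel P] {f : S → ℝ≥0∞}
    (hf : Measurable f) (n : ℕ) : Measurable (iterMean P f n) := by
  induction n with
  | zero => exact hf.comp measurable_snd
  | succ n ih =>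
    have h : Measurable fun r : (Y × S) × S => iterMean P f n (r.1.1, r.2) := by fun_prop
    exact h.lintegral_kernel_prod_right' (κ := P)

theorem iterMean_le_one (P : Kernel (Y × S) S) [IsMarkovKernel P] {f : S → ℝ≥0∞}
    (hf : ∀ x, f x ≤ 1) (n : ℕ) (p : Y × S) : iterMean P f n p ≤ 1 := by
  induction n generalizing p with
  | zero => exact hf _
  | succ n ih => exact (lintegral_mono fun y => ih (p.1, y)).trans (by simp)

theorem lintegral_le_add_mul_of_tvDist_le (κ : ℕ → Measure S) [∀ k, IsProbabilityMeasure (κ k)]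
    {g : ℝ} (hκ : ∀ k, tvDist (κ (k + 1)) (κ k) ≤ g) {f : S → ℝ≥0∞}
    (hf : Measurable f) (hf1 : ∀ x, f x ≤ 1) (k : ℕ) :
    ∫⁻ y, f y ∂κ k ≤ ∫⁻ y, f y ∂κ 0 + k * ENNReal.ofReal g := by
  induction k with
  | zero => simp
  | succ k ih =>
    calc ∫⁻ y, f y ∂κ (k + 1) ≤ ∫⁻ y, f y ∂κ k + ENNReal.ofReal (tvDist (κ (k + 1)) (κ k)) :=
          lintegral_le_lintegral_add_tvDist _ _ hf hf1
      _ ≤ ∫⁻ y, f y ∂κ 0 + k * ENNReal.ofReal g + ENNReal.ofReal g := by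
          gcongr
          exact hκ k
      _ = _ := by push_cast; ring

/-- From a diminishing time on, the adaptive process is close to the chain whose parameter is
frozen. -/
theorem adaptiveMarginal_le_iterMean (Q : AdaptationPlan Y S) (P : Kernel (Y × S) S)
    [IsMarkovKernel P] (γ₀ : Y) (x₀ : S) {d : ℕ → ℝ} {η : ℝ} {s : ℕ}
    (hs : IsDiminishingTime P (adaptiveLaw Q P γ₀ x₀) d η s) {T : ℕ} (hT : s ≤ T) {g : ℝ}
    (hg : ∀ n, T ≤ n → d n ≤ g) (t : ℕ) {A : Set S} (hA : MeasurableSet A) :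
    adaptiveMarginal Q P γ₀ x₀ (T + t) A ≤
      ∫⁻ ω, iterMean P (A.indicator 1) t ((ω (T + 1)).1, (ω T).2) ∂adaptiveLaw Q P γ₀ x₀ +
        ∑ k ∈ Finset.range t, (k : ℝ≥0∞) * ENNReal.ofReal g + ENNReal.ofReal η := by
  have hf : Measurable (A.indicator (1 : S → ℝ≥0∞)) := measurable_one.indicator hA
  have hf1 : ∀ x, A.indicator (1 : S → ℝ≥0∞) x ≤ 1 := fun x =>
    Set.indicator_le_self' (fun _ _ => zero_le) x
  -- `Z k` is the value of running the frozen chain for the `t - k` steps still to go. It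
  -- interpolates between the frozen chain (`k = 0`) and the adaptive one (`k = t`). At step `k` the
  -- parameter is `k` increments away from the frozen one, whence the error `k * g`; freezing at
  -- time `T + 1` makes the first error zero.
  obtain ⟨hE, htel⟩ := lintegral_adaptiveLaw_telescope Q P γ₀ x₀ T
    (Z := fun k => iterMean P (A.indicator 1) (t - k)) (fun k => measurable_iterMean P hf _)
    (fun k => k * ENNReal.ofReal g) t
  set E : Set (ℕ → Y × S) := _ with hEdef
  change MeasurableSet E at hE
  change ∫⁻ ω in E, _ ∂_ ≤ _ at htel
  -- The admissible event quantifies over all states and need not be measurable. The set `E` is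
  -- measurable and contains it, so the integral is split along `E`.
  have hbad : adaptiveLaw Q P γ₀ x₀ Eᶜ ≤ ENNReal.ofReal η := by
    refine (measure_mono (t := {ω | ¬ ∀ n, s ≤ n → ∀ x : S,
      tvDist (P ((ω (n + 1)).1, x)) (P ((ω n).1, x)) ≤ d n}) ?_).trans
      (by rw [← ofReal_measureReal]; exact ENNReal.ofReal_le_ofReal hs)
    intro ω hω hgood
    refine hω fun j hj => ?_
    have hsucc : t - j = t - (j + 1) + 1 := by omega
    have h := lintegral_le_add_mul_of_tvDist_le
      (fun k => P ((ω (T + k + 1)).1, (ω (T + j)).2)) (g := g)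
      (fun k => (hgood (T + k + 1) (by omega) _).trans (hg _ (by omega)))
      (f := fun y => iterMean P (A.indicator 1) (t - (j + 1)) ((ω (T + 1)).1, y))
      ((measurable_iterMean P hf _).comp measurable_prodMk_left)
      (fun y => iterMean_le_one P hf1 _ _) j
    simp only [hsucc]
    exact h
  have hX : Measurable fun ω : ℕ → Y × S => (ω (T + t)).2 := by fun_prop
  calc adaptiveMarginal Q P γ₀ x₀ (T + t) A
      = ∫⁻ ω, A.indicator 1 (ω (T + t)).2 ∂adaptiveLaw Q P γ₀ x₀ := by
        rw [adaptiveMarginal, ← lintegral_indicator_one hA, lintegral_map hf hX]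
    _ = ∫⁻ ω in E, A.indicator 1 (ω (T + t)).2 ∂adaptiveLaw Q P γ₀ x₀ +
          ∫⁻ ω in Eᶜ, A.indicator 1 (ω (T + t)).2 ∂adaptiveLaw Q P γ₀ x₀ :=
        (lintegral_add_compl _ hE).symm
    _ ≤ _ := by
        gcongr
        · simpa [iterMean] using htel
        · refine (lintegral_mono fun ω => hf1 _).trans ?_
          simpa using hbad

end AdaptiveProcess

/-! ### The independence Metropolis–Hastings sampler with a fixed parameter -/

theorem lintegral_exp_neg_mul_lebNN {a : ℝ} (ha : 0 < a) :
    ∫⁻ y, ENNReal.ofReal (Real.exp (-a * (y : ℝ))) ∂lebNN = ENNReal.ofReal (1 / a) := by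
  rw [lintegral_lebNN (fun y => ENNReal.ofReal (Real.exp (-a * y))), ← restrict_Ioi_eq_restrict_Ici,
    ← ofReal_integral_eq_lintegral_ofReal (integrableOn_exp_mul_Ioi (a := -a) (by linarith) 0)
      (ae_of_all _ fun y => by positivity), integral_exp_mul_Ioi (by linarith)]
  simp

theorem lintegral_const_mul_exp_lebNN {a b : ℝ} (ha : 0 < a) (hb : 0 ≤ b) :
    ∫⁻ y, ENNReal.ofReal (b * Real.exp (-a * (y : ℝ))) ∂lebNN = ENNReal.ofReal (b / a) := by
  simp_rw [ENNReal.ofReal_mul hb]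
  rw [lintegral_const_mul _ (by fun_prop), lintegral_exp_neg_mul_lebNN ha, ← ENNReal.ofReal_mul hb,
    mul_one_div]

instance : IsProbabilityMeasure expTarget := by
  constructor
  have h := lintegral_exp_neg_mul_lebNN one_pos
  rw [expTarget, withDensity_apply _ MeasurableSet.univ, Measure.restrict_univ]
  simpa using h

theorem lintegral_expTarget {f : ℝ≥0 → ℝ≥0∞} (hf : Measurable f) :
    ∫⁻ x, f x ∂expTarget = ∫⁻ x, ENNReal.ofReal (Real.exp (-(x : ℝ))) * f x ∂lebNN := by
  rw [expTarget, lintegral_withDensity_eq_lintegral_mul _ (by fun_prop) hf]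
  rfl

theorem lintegral_exp_expTarget {ε : ℝ} (hε : 0 < ε) :
    ∫⁻ x, ENNReal.ofReal (Real.exp ((1 - ε) * (x : ℝ))) ∂expTarget = ENNReal.ofReal (1 / ε) := by
  rw [lintegral_expTarget (by fun_prop), ← lintegral_exp_neg_mul_lebNN hε]
  refine lintegral_congr fun x => ?_
  rw [← ENNReal.ofReal_mul (Real.exp_nonneg _), ← Real.exp_add]
  ring_nf

theorem measurable_imhDensity_right (γ : ℝ) (x : ℝ≥0) : Measurable (imhDensity γ x) :=
  measurable_imhDensity.comp (measurable_prodMk_left (x := (γ, x)))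

theorem lintegral_imhMeasure (γ : ℝ) (x : ℝ≥0) {f : ℝ≥0 → ℝ≥0∞} (hf : Measurable f) :
    ∫⁻ y, f y ∂imhMeasure γ x =
      ∫⁻ y, ENNReal.ofReal (imhDensity γ x y) * f y ∂lebNN +
        ENNReal.ofReal (imhReject γ x) * f x := by
  rw [imhMeasure, lintegral_add_measure, lintegral_smul_measure, lintegral_dirac' _ hf,
    lintegral_withDensity_eq_lintegral_mul _ (measurable_imhDensity_right γ x).ennreal_ofReal hf]
  rfl

theorem lintegral_imhDensity_add_reject {γ : ℝ} (hγ : 0 < γ) (x : ℝ≥0) :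
    ∫⁻ y, ENNReal.ofReal (imhDensity γ x y) ∂lebNN + ENNReal.ofReal (imhReject γ x) = 1 := by
  have := isProbabilityMeasure_imhMeasure hγ x
  have h := lintegral_imhMeasure γ x (measurable_one (α := ℝ≥0∞))
  simpa using h.symm

theorem imhReject_le_one {γ : ℝ} (hγ : 0 ≤ γ) (x : ℝ≥0) : imhReject γ x ≤ 1 := by
  have : 0 ≤ ∫ y, imhDensity γ x y ∂lebNN := integral_nonneg fun y => imhDensity_nonneg hγ x y
  unfold imhReject; linarith

theorem imhDensity_le {γ : ℝ} (hγ : 0 ≤ γ) (x y : ℝ≥0) :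
    imhDensity γ x y ≤ γ * Real.exp (-γ * y) :=
  mul_le_of_le_one_left (by positivity) (min_le_right _ _)

theorem imhAccept_anti {γ : ℝ} (hγ : 1 ≤ γ) {x x' : ℝ≥0} (hx : x' ≤ x) (y : ℝ≥0) :
    imhAccept γ x y ≤ imhAccept γ x' y := by
  have : (x' : ℝ) ≤ x := hx
  refine min_le_min (Real.exp_le_exp.2 (mul_le_mul_of_nonneg_left ?_ (by linarith))) le_rfl
  linarith

theorem imhDensity_anti {γ : ℝ} (hγ : 1 ≤ γ) {x x' : ℝ≥0} (hx : x' ≤ x) (y : ℝ≥0) :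
    imhDensity γ x y ≤ imhDensity γ x' y :=
  mul_le_mul_of_nonneg_right (imhAccept_anti hγ hx y) (by positivity)

theorem imhAccept_eq_one {γ : ℝ} (hγ : 1 ≤ γ) {x y : ℝ≥0} (hx : x ≤ y) : imhAccept γ x y = 1 := by
  have : (x : ℝ) ≤ y := hx
  exact min_eq_right (Real.one_le_exp (mul_nonneg (by linarith) (by linarith)))

/-- The worst proposal is `y = 0`: every proposal is accepted with probability at least `exp (-(γ -
1) * x)`. -/
theorem imhReject_le {γ : ℝ} (hγ : 1 ≤ γ) (x : ℝ≥0) :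
    imhReject γ x ≤ 1 - Real.exp (-(γ - 1) * x) := by
  have hγ0 : 0 < γ := by linarith
  have h1 := lintegral_imhDensity_add_reject hγ0 x
  have h2 : ENNReal.ofReal (Real.exp (-(γ - 1) * x)) ≤
      ∫⁻ y, ENNReal.ofReal (imhDensity γ x y) ∂lebNN := by
    have h3 := lintegral_const_mul_exp_lebNN hγ0
      (b := Real.exp (-(γ - 1) * x) * γ) (by positivity)
    rw [mul_div_assoc, div_self hγ0.ne', mul_one] at h3
    rw [← h3]
    refine lintegral_mono fun y => ENNReal.ofReal_le_ofReal ?_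
    rw [mul_assoc]
    refine mul_le_mul_of_nonneg_right (le_min (Real.exp_le_exp.2 ?_) (Real.exp_le_one_iff.2 ?_))
      (by positivity)
    · have : 0 ≤ (γ - 1) * (y : ℝ) := mul_nonneg (by linarith) y.2
      nlinarith
    · have : 0 ≤ (γ - 1) * (x : ℝ) := mul_nonneg (by linarith) x.2
      nlinarith
  have h4 : ENNReal.ofReal (Real.exp (-(γ - 1) * x)) + ENNReal.ofReal (imhReject γ x) ≤ 1 :=
    h1 ▸ (add_le_add_left h2 _)
  rcases le_total (imhReject γ x) 0 with h0 | h0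
  · have : Real.exp (-(γ - 1) * x) ≤ 1 := Real.exp_le_one_iff.2 (by
      have : 0 ≤ (γ - 1) * (x : ℝ) := mul_nonneg (by linarith) x.2
      nlinarith)
    linarith
  · rw [← ENNReal.ofReal_add (Real.exp_nonneg _) h0, ENNReal.ofReal_le_one] at h4
    linarith

/-- Additive drift of `x ↦ exp ((1 - ε) x)`. -/
theorem lintegral_exp_imhMeasure_le {γ ε : ℝ} (hγ : 0 < γ) (hγε : 0 < γ - 1 + ε) (x : ℝ≥0) :
    ∫⁻ y, ENNReal.ofReal (Real.exp ((1 - ε) * (y : ℝ))) ∂imhMeasure γ x ≤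
      ENNReal.ofReal (Real.exp ((1 - ε) * (x : ℝ))) + ENNReal.ofReal (γ / (γ - 1 + ε)) := by
  rw [lintegral_imhMeasure γ x (by fun_prop), add_comm]
  -- Rejection contributes at most the old value; acceptance contributes at most the mean under the
  -- proposal, which is `γ / (γ - 1 + ε)`.
  refine add_le_add ?_ ?_
  · refine mul_le_of_le_one_left zero_le ?_
    simpa using imhReject_le_one hγ.le x
  · rw [← lintegral_const_mul_exp_lebNN hγε hγ.le]
    refine lintegral_mono fun y => ?_
    rw [← ENNReal.ofReal_mul (imhDensity_nonneg hγ.le x y)]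
    refine ENNReal.ofReal_le_ofReal ?_
    calc imhDensity γ x y * Real.exp ((1 - ε) * y)
        ≤ γ * Real.exp (-γ * y) * Real.exp ((1 - ε) * y) := by
          gcongr; exact imhDensity_le hγ.le x y
      _ = γ * Real.exp (-(γ - 1 + ε) * y) := by
          rw [mul_assoc, ← Real.exp_add]; ring_nf

/-- The next state lies beyond `b` only if the chain was there and stayed, or if the proposal falls
there, which has probability `exp (-γ * b)`. -/
theorem lintegral_indicator_imhMeasure_le {γ b : ℝ} (hγ : 0 < γ) (hb : 0 ≤ b) (x : ℝ≥0) :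
    ∫⁻ y, ({y : ℝ≥0 | b < y}.indicator 1 y : ℝ≥0∞) ∂imhMeasure γ x ≤
      {y : ℝ≥0 | b < y}.indicator 1 x + ENNReal.ofReal (Real.exp (-γ * b)) := by
  have hm : MeasurableSet {y : ℝ≥0 | b < y} := measurableSet_lt measurable_const (by fun_prop)
  rw [lintegral_imhMeasure γ x (measurable_one.indicator hm), add_comm]
  refine add_le_add ?_ ?_
  · refine mul_le_of_le_one_left zero_le ?_
    simpa using imhReject_le_one hγ.le x
  · have h1 : ∀ y : ℝ≥0, ENNReal.ofReal (imhDensity γ x y) *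
        ({y : ℝ≥0 | b < y}.indicator 1 y : ℝ≥0∞) ≤
        (Set.Ioi b).indicator (fun z => ENNReal.ofReal (γ * Real.exp (-γ * z))) (y : ℝ) := by
      intro y
      by_cases hy : b < (y : ℝ)
      · rw [Set.indicator_of_mem (show y ∈ {y : ℝ≥0 | b < y} from hy),
          Set.indicator_of_mem (show (y : ℝ) ∈ Set.Ioi b from hy)]
        simpa using ENNReal.ofReal_le_ofReal (imhDensity_le hγ.le x y)
      · rw [Set.indicator_of_notMem (show y ∉ {y : ℝ≥0 | b < y} from hy)]
        simp
    refine (lintegral_mono h1).trans ?_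
    rw [lintegral_lebNN, lintegral_indicator measurableSet_Ioi,
      Measure.restrict_restrict measurableSet_Ioi,
      Set.inter_eq_left.2 (show Set.Ioi b ⊆ Set.Ici 0 from fun z hz => (hb.trans_lt hz).le)]
    rw [← ofReal_integral_eq_lintegral_ofReal
      ((integrableOn_exp_mul_Ioi (a := -γ) (by linarith) b).const_mul γ)
      (ae_of_all _ fun y => by positivity), integral_const_mul, integral_exp_mul_Ioi (by linarith)]
    refine ENNReal.ofReal_le_ofReal (le_of_eq ?_)
    field_simp

theorem expTarget_tail {b : ℝ} (hb : 0 ≤ b) :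
    expTarget {y : ℝ≥0 | b < y} = ENNReal.ofReal (Real.exp (-b)) := by
  have hm : MeasurableSet {y : ℝ≥0 | b < y} := measurableSet_lt measurable_const (by fun_prop)
  rw [expTarget, withDensity_apply _ hm, ← lintegral_indicator hm]
  have h1 : ∀ y : ℝ≥0, {y : ℝ≥0 | b < y}.indicator
      (fun y => ENNReal.ofReal (Real.exp (-(y : ℝ)))) y =
      (Set.Ioi b).indicator (fun z => ENNReal.ofReal (Real.exp (-1 * z))) (y : ℝ) := by
    intro y; simp [Set.indicator]
  rw [lintegral_congr h1, lintegral_lebNN, lintegral_indicator measurableSet_Ioi,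
      Measure.restrict_restrict measurableSet_Ioi,
      Set.inter_eq_left.2 (show Set.Ioi b ⊆ Set.Ici 0 from fun z hz => (hb.trans_lt hz).le),
      ← ofReal_integral_eq_lintegral_ofReal
      (integrableOn_exp_mul_Ioi (a := -1) (by norm_num) b)
      (ae_of_all _ fun y => by positivity), integral_exp_mul_Ioi (by norm_num)]
  simp

/-- Detailed balance for the absolutely continuous part. -/
theorem exp_mul_imhDensity_comm {γ : ℝ} (hγ : 1 ≤ γ) (x y : ℝ≥0) :
    Real.exp (-(x : ℝ)) * imhDensity γ x y = Real.exp (-(y : ℝ)) * imhDensity γ y x := by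
  wlog h : x ≤ y generalizing x y
  · exact (this y x (le_of_not_ge h)).symm
  have h' : (x : ℝ) ≤ y := h
  have h2 : imhAccept γ y x = Real.exp ((γ - 1) * ((x : ℝ) - y)) :=
    min_eq_left (Real.exp_le_one_iff.2 (mul_nonpos_of_nonneg_of_nonpos (by linarith) (by linarith)))
  rw [imhDensity, imhDensity, imhAccept_eq_one hγ h, h2]
  have : Real.exp (-(x : ℝ)) * Real.exp (-γ * y) =
      Real.exp (-(y : ℝ)) * (Real.exp ((γ - 1) * ((x : ℝ) - y)) * Real.exp (-γ * x)) := by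
    rw [← Real.exp_add, ← Real.exp_add, ← Real.exp_add]; ring_nf
  linear_combination γ * this

/-- Fubini and detailed balance turn the accepted part into `f` weighted by the acceptance
probability at its own point; the rejection part completes this weight to `1`. -/
theorem lintegral_lintegral_imhMeasure_expTarget {γ : ℝ} (hγ : 1 ≤ γ) {f : ℝ≥0 → ℝ≥0∞}
    (hf : Measurable f) :
    ∫⁻ x, ∫⁻ y, f y ∂imhMeasure γ x ∂expTarget = ∫⁻ x, f x ∂expTarget := by
  have hγ0 : 0 < γ := by linarith
  have hD : Measurable fun q : ℝ≥0 × ℝ≥0 => ENNReal.ofReal (imhDensity γ q.1 q.2) :=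
    (measurable_imhDensity.comp (f := fun q : ℝ≥0 × ℝ≥0 => ((γ, q.1), q.2))
      (by fun_prop)).ennreal_ofReal
  have hR : Measurable fun x : ℝ≥0 => ENNReal.ofReal (imhReject γ x) :=
    (measurable_imhReject.comp (f := fun x : ℝ≥0 => (γ, x)) (by fun_prop)).ennreal_ofReal
  set p : ℝ≥0 → ℝ≥0∞ := fun x => ENNReal.ofReal (Real.exp (-(x : ℝ))) with hp
  have hpm : Measurable p := by rw [hp]; fun_prop
  have hbal : ∀ x y, p x * ENNReal.ofReal (imhDensity γ x y) =
      p y * ENNReal.ofReal (imhDensity γ y x) := fun x y => by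
    rw [hp, ← ENNReal.ofReal_mul (Real.exp_nonneg _), exp_mul_imhDensity_comm hγ,
      ENNReal.ofReal_mul (Real.exp_nonneg _)]
  have hin : Measurable fun x => ∫⁻ y, ENNReal.ofReal (imhDensity γ x y) * f y ∂lebNN :=
    (hD.mul (hf.comp measurable_snd)).lintegral_prod_right'
  have hin1 : Measurable fun x => ∫⁻ y, ENNReal.ofReal (imhDensity γ x y) ∂lebNN :=
    hD.lintegral_prod_right'
  simp_rw [lintegral_imhMeasure γ _ hf]
  rw [lintegral_expTarget (f := fun x => ∫⁻ y, ENNReal.ofReal (imhDensity γ x y) * f y ∂lebNN +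
    ENNReal.ofReal (imhReject γ x) * f x) (hin.add (hR.mul hf)), lintegral_expTarget hf]
  change ∫⁻ x, p x * _ ∂lebNN = ∫⁻ x, p x * f x ∂lebNN
  simp_rw [mul_add]
  rw [lintegral_add_left (f := fun x => p x * ∫⁻ y, ENNReal.ofReal (imhDensity γ x y) * f y ∂lebNN)
    (hpm.mul hin)]
  have hswap : ∫⁻ x, p x * ∫⁻ y, ENNReal.ofReal (imhDensity γ x y) * f y ∂lebNN ∂lebNN =
      ∫⁻ y, p y * (f y * ∫⁻ x, ENNReal.ofReal (imhDensity γ y x) ∂lebNN) ∂lebNN := by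
    calc _ = ∫⁻ x, ∫⁻ y, p x * (ENNReal.ofReal (imhDensity γ x y) * f y) ∂lebNN ∂lebNN := by
          refine lintegral_congr fun x => (lintegral_const_mul _ ?_).symm
          exact (hD.comp measurable_prodMk_left).mul hf
      _ = ∫⁻ y, ∫⁻ x, p x * (ENNReal.ofReal (imhDensity γ x y) * f y) ∂lebNN ∂lebNN := by
          refine lintegral_lintegral_swap (Measurable.aemeasurable ?_)
          exact (hpm.comp measurable_fst).mul (hD.mul (hf.comp measurable_snd))
      _ = _ := by
          refine lintegral_congr fun y => ?_
          rw [← mul_assoc, ← lintegral_const_mul _ (measurable_imhDensity_right γ y).ennreal_ofReal]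
          refine lintegral_congr fun x => ?_
          rw [← mul_assoc, hbal x y]
          ring
  rw [hswap, ← lintegral_add_left
    (f := fun y => p y * (f y * ∫⁻ x, ENNReal.ofReal (imhDensity γ y x) ∂lebNN))
    (hpm.mul (hf.mul hin1))]
  refine lintegral_congr fun x => ?_
  calc _ = p x * f x * (∫⁻ y, ENNReal.ofReal (imhDensity γ x y) ∂lebNN +
        ENNReal.ofReal (imhReject γ x)) := by ring
    _ = _ := by rw [lintegral_imhDensity_add_reject hγ0, mul_one]

/-! ### Convergence of the sampler with a fixed parameter -/

/-- Started from `x' ≤ x`, two copies of the sampler can be kept together once the proposal is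
accepted at the larger state, which does not move before. -/
theorem iterMean_imhKernel_le {γl γu : ℝ} (h : 1 < γl) (γ : Set.Ioo γl γu) {f : ℝ≥0 → ℝ≥0∞}
    (hf : Measurable f) (hf1 : ∀ x, f x ≤ 1) (t : ℕ) (x x' : ℝ≥0) (hx : x' ≤ x) :
    iterMean (imhKernel γl γu h) f t (γ, x) ≤
      iterMean (imhKernel γl γu h) f t (γ, x') + ENNReal.ofReal (imhReject γ x) ^ t ∧
    iterMean (imhKernel γl γu h) f t (γ, x') ≤
      iterMean (imhKernel γl γu h) f t (γ, x) + ENNReal.ofReal (imhReject γ x) ^ t := by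
  induction t generalizing x x' with
  | zero => exact ⟨by simpa [iterMean] using (hf1 x).trans le_add_self,
      by simpa [iterMean] using (hf1 x').trans le_add_self⟩
  | succ t ih =>
    have hγ : 1 ≤ (γ : ℝ) := (h.trans γ.2.1).le
    have hγ0 : 0 < (γ : ℝ) := by linarith
    set g : ℝ≥0 → ℝ≥0∞ := fun y => iterMean (imhKernel γl γu h) f t (γ, y) with hg
    have hgm : Measurable g := (measurable_iterMean _ hf t).comp measurable_prodMk_left
    have hiter : ∀ z, iterMean (imhKernel γl γu h) f (t + 1) (γ, z) =
        ∫⁻ y, ENNReal.ofReal (imhDensity γ z y) * g y ∂lebNN +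
          ENNReal.ofReal (imhReject γ z) * g z := fun z => lintegral_imhMeasure γ z hgm
    -- The coupling in terms of densities: `D` is the proposal accepted from both states, `Δ` the
    -- proposal accepted from `x'` alone, and `r'` the joint rejection. `Δ` vanishes above `x`, so
    -- the order of the two copies is preserved. The copies are apart only on the last two parts, of
    -- total mass `r`, where the upper copy is still at `x`; the induction hypothesis then
    -- contributes `r ^ t`.
    set D : ℝ≥0 → ℝ≥0∞ := fun y => ENNReal.ofReal (imhDensity γ x y) with hD
    set Δ : ℝ≥0 → ℝ≥0∞ := fun y => ENNReal.ofReal (imhDensity γ x' y) - D y with hΔ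
    set r : ℝ≥0∞ := ENNReal.ofReal (imhReject γ x) with hr
    set r' : ℝ≥0∞ := ENNReal.ofReal (imhReject γ x') with hr'
    have hDm : Measurable D := (measurable_imhDensity_right γ x).ennreal_ofReal
    have hΔm : Measurable Δ := (measurable_imhDensity_right γ x').ennreal_ofReal.sub hDm
    have hsplit : ∀ y, ENNReal.ofReal (imhDensity γ x' y) = D y + Δ y := fun y =>
      (add_tsub_cancel_of_le (ENNReal.ofReal_le_ofReal (imhDensity_anti hγ hx y))).symm
    have hΔ0 : ∀ y, x ≤ y → Δ y = 0 := fun y hy => by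
      simp [hΔ, hD, imhDensity, imhAccept_eq_one hγ hy, imhAccept_eq_one hγ (hx.trans hy)]
    have hrr : r = ∫⁻ y, Δ y ∂lebNN + r' := by
      have h1 := lintegral_imhDensity_add_reject hγ0 x
      have h2 := lintegral_imhDensity_add_reject hγ0 x'
      simp_rw [hsplit] at h2
      rw [lintegral_add_left hDm, add_assoc] at h2
      have hfin : ∫⁻ y, D y ∂lebNN ≠ ∞ :=
        ((lintegral_imhDensity_le hγ0 x).trans_lt ENNReal.one_lt_top).ne
      exact (ENNReal.add_right_inj hfin).1 (h1.trans h2.symm)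
    have hx'1 : ∫⁻ y, ENNReal.ofReal (imhDensity γ x' y) * g y ∂lebNN =
        ∫⁻ y, D y * g y ∂lebNN + ∫⁻ y, Δ y * g y ∂lebNN := by
      simp_rw [hsplit, add_mul]
      exact lintegral_add_left (hDm.mul hgm) _
    have hΔle : ∀ {u v : ℝ≥0 → ℝ≥0∞}, (∀ y < x, u y ≤ v y) →
        ∫⁻ y, Δ y * u y ∂lebNN ≤ ∫⁻ y, Δ y * v y ∂lebNN := fun {u v} huv => by
      refine lintegral_mono fun y => ?_
      rcases le_or_gt x y with hy | hy
      · simp [hΔ0 y hy]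
      · exact mul_le_mul_right (huv y hy) _
    rw [hiter, hiter, hx'1]
    constructor
    · calc ∫⁻ y, D y * g y ∂lebNN + r * g x
          = ∫⁻ y, D y * g y ∂lebNN + (∫⁻ y, Δ y * g x ∂lebNN + r' * g x) := by
            rw [lintegral_mul_const _ hΔm, ← add_mul, ← hrr]
        _ ≤ ∫⁻ y, D y * g y ∂lebNN + (∫⁻ y, Δ y * (g y + r ^ t) ∂lebNN + r' * (g x' + r ^ t)) := by
            refine add_le_add le_rfl (add_le_add (hΔle fun y hy => (ih x y hy.le).1) ?_)
            exact mul_le_mul_right (ih x x' hx).1 _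
        _ = ∫⁻ y, D y * g y ∂lebNN + ∫⁻ y, Δ y * g y ∂lebNN + r' * g x' +
              (∫⁻ y, Δ y ∂lebNN + r') * r ^ t := by
            simp_rw [mul_add]
            rw [lintegral_add_left (f := fun y => Δ y * g y) (hΔm.mul hgm), lintegral_mul_const _ hΔm]
            ring
        _ = _ := by rw [← hrr, pow_succ']
    · calc ∫⁻ y, D y * g y ∂lebNN + ∫⁻ y, Δ y * g y ∂lebNN + r' * g x'
          ≤ ∫⁻ y, D y * g y ∂lebNN + ∫⁻ y, Δ y * (g x + r ^ t) ∂lebNN + r' * (g x + r ^ t) := by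
            refine add_le_add (add_le_add le_rfl (hΔle fun y hy => (ih x y hy.le).2)) ?_
            exact mul_le_mul_right (ih x x' hx).2 _
        _ = ∫⁻ y, D y * g y ∂lebNN + (∫⁻ y, Δ y ∂lebNN + r') * g x +
              (∫⁻ y, Δ y ∂lebNN + r') * r ^ t := by
            rw [lintegral_mul_const _ hΔm]
            ring
        _ = _ := by rw [← hrr, pow_succ']

theorem lintegral_iterMean_imhKernel {γl γu : ℝ} (h : 1 < γl) (γ : Set.Ioo γl γu)
    {f : ℝ≥0 → ℝ≥0∞} (hf : Measurable f) (t : ℕ) :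
    ∫⁻ x, iterMean (imhKernel γl γu h) f t (γ, x) ∂expTarget = ∫⁻ x, f x ∂expTarget := by
  induction t with
  | zero => rfl
  | succ t ih =>
    rw [← ih]
    exact lintegral_lintegral_imhMeasure_expTarget (h.trans γ.2.1).le
      ((measurable_iterMean (imhKernel γl γu h) hf t).comp (measurable_prodMk_left (x := γ)))

/-- Compare with a copy started from the invariant law. The rejection power at the larger of the two
starting points is bounded by the sum of both powers, which avoids distinguishing which one is
larger. -/
theorem iterMean_imhKernel_le_expTarget {γl γu : ℝ} (h : 1 < γl) (γ : Set.Ioo γl γu)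
    {A : Set ℝ≥0} (hA : MeasurableSet A) (t : ℕ) (x : ℝ≥0) :
    iterMean (imhKernel γl γu h) (A.indicator 1) t (γ, x) ≤
      expTarget A + (ENNReal.ofReal (imhReject γ x) ^ t +
        ∫⁻ y, ENNReal.ofReal (imhReject γ y) ^ t ∂expTarget) := by
  have hf : Measurable (A.indicator (1 : ℝ≥0 → ℝ≥0∞)) := measurable_one.indicator hA
  have hf1 : ∀ x, A.indicator (1 : ℝ≥0 → ℝ≥0∞) x ≤ 1 := fun x =>
    Set.indicator_le_self' (fun _ _ => zero_le) x
  calc iterMean (imhKernel γl γu h) (A.indicator 1) t (γ, x)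
      = ∫⁻ _, iterMean (imhKernel γl γu h) (A.indicator 1) t (γ, x) ∂expTarget := by simp
    _ ≤ ∫⁻ y, (iterMean (imhKernel γl γu h) (A.indicator 1) t (γ, y) +
          (ENNReal.ofReal (imhReject γ x) ^ t + ENNReal.ofReal (imhReject γ y) ^ t)) ∂expTarget := by
        refine lintegral_mono fun y => ?_
        rcases le_total y x with hy | hy
        · exact (iterMean_imhKernel_le h γ hf hf1 t x y hy).1.trans (by gcongr; exact le_self_add)
        · exact (iterMean_imhKernel_le h γ hf hf1 t y x hy).2.trans (by gcongr; exact le_add_self)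
    _ = _ := by
        rw [lintegral_add_left (f := fun y => iterMean (imhKernel γl γu h) (A.indicator 1) t (γ, y))
            ((measurable_iterMean (imhKernel γl γu h) hf t).comp (measurable_prodMk_left (x := γ))),
          lintegral_add_left measurable_const, lintegral_iterMean_imhKernel h γ hf,
          lintegral_indicator_one hA]
        simp

/-- With `s = exp (-(γu - 1) * x)` the rejection probability is at most `1 - s ≤ exp (-s)`. Since `s
≤ 1`, one has `s * (1 + c * t) ≤ 1 + c * t * s ≤ exp (c * t * s)`. Raising this to the power `-w`,
where `w = 1 / c`, trades exponential decay at rate `s` for polynomial decay times `s ^ (-w) = exp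
((1 - ε) * x)`. -/
theorem imhReject_pow_le {γ γu ε : ℝ} (hγ : 1 < γ) (hγu : γ < γu) (hε : ε < 1) (x : ℝ≥0) (t : ℕ) :
    ENNReal.ofReal (imhReject γ x) ^ t ≤
      ENNReal.ofReal ((1 + (γu - 1) / (1 - ε) * t) ^ (-((1 - ε) / (γu - 1)))) *
        ENNReal.ofReal (Real.exp ((1 - ε) * x)) := by
  set c := (γu - 1) / (1 - ε) with hc
  set w := (1 - ε) / (γu - 1) with hw
  have hγu' : 0 < γu - 1 := by linarith
  have hε' : 0 < 1 - ε := by linarith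
  have hc0 : 0 < c := div_pos hγu' hε'
  have hw0 : 0 < w := div_pos hε' hγu'
  have hcw : c * w = 1 := by rw [hc, hw]; field_simp
  set s := Real.exp (-(γu - 1) * x) with hs
  have hs1 : s ≤ 1 := Real.exp_le_one_iff.2 (by nlinarith [x.2, mul_nonneg hγu'.le x.2])
  have hs0 : 0 < s := Real.exp_pos _
  have hrej : imhReject γ x ≤ Real.exp (-s) := by
    have h1 : s ≤ Real.exp (-(γ - 1) * x) := Real.exp_le_exp.2 (by nlinarith [x.2])
    have h2 := Real.add_one_le_exp (-s)
    linarith [imhReject_le hγ.le x]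
  have hbase : 0 < 1 + c * t := by positivity
  have hkey : s * (1 + c * t) ≤ Real.exp (c * t * s) := by
    have := Real.add_one_le_exp (c * t * s)
    linarith
  have hexp : Real.exp ((1 - ε) * x) = s ^ (-w) := by
    rw [hs, ← Real.exp_mul, hw]
    congr 1
    field_simp
  rw [← ENNReal.ofReal_mul (by positivity)]
  calc ENNReal.ofReal (imhReject γ x) ^ t ≤ ENNReal.ofReal (Real.exp (-s)) ^ t := by gcongr
    _ = ENNReal.ofReal (Real.exp (-s) ^ t) := (ENNReal.ofReal_pow (Real.exp_nonneg _) t).symm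
    _ ≤ _ := by
      refine ENNReal.ofReal_le_ofReal ?_
      have h3 : Real.exp (-s) ^ t = Real.exp (c * t * s) ^ (-w) := by
        rw [← Real.exp_nat_mul, ← Real.exp_mul]
        congr 1
        linear_combination (t * s : ℝ) * hcw
      rw [h3, hexp, mul_comm ((1 + c * (t : ℝ)) ^ (-w)), ← Real.mul_rpow hs0.le hbase.le]
      exact Real.rpow_le_rpow_of_nonpos (by positivity) hkey (by linarith)

theorem iterMean_imhKernel_le_rate {γl γu ε : ℝ} (h : 1 < γl) (hε0 : 0 < ε) (hε1 : ε < 1)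
    (γ : Set.Ioo γl γu) {A : Set ℝ≥0} (hA : MeasurableSet A) (t : ℕ) (x : ℝ≥0) :
    iterMean (imhKernel γl γu h) (A.indicator 1) t (γ, x) ≤ expTarget A +
      ENNReal.ofReal ((1 + (γu - 1) / (1 - ε) * t) ^ (-((1 - ε) / (γu - 1)))) *
        (ENNReal.ofReal (Real.exp ((1 - ε) * x)) + ENNReal.ofReal (1 / ε)) := by
  refine (iterMean_imhKernel_le_expTarget h γ hA t x).trans ?_
  rw [mul_add]
  gcongr
  · exact imhReject_pow_le (h.trans γ.2.1) γ.2.2 hε1 x t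
  · rw [← lintegral_exp_expTarget hε0, ← lintegral_const_mul _ (by fun_prop)]
    exact lintegral_mono fun y => imhReject_pow_le (h.trans γ.2.1) γ.2.2 hε1 y t

/-! ### Lipschitz dependence on the tuning parameter -/

/-- In this form the parameter enters only through `γ * exp (-(γ - 1) * max x y)`, which is
Lipschitz in `γ` uniformly in both states, while the factor `exp (-y)` keeps the difference
integrable. -/
theorem imhDensity_eq {γ : ℝ} (hγ : 1 ≤ γ) (x y : ℝ≥0) :
    imhDensity γ x y =
      γ * Real.exp (-(γ - 1) * max (x : ℝ) y) * Real.exp (-(y : ℝ)) := by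
  rcases le_total x y with h | h
  · have h' : (x : ℝ) ≤ y := h
    rw [imhDensity, imhAccept_eq_one hγ h, max_eq_right h', mul_assoc, ← Real.exp_add]
    ring_nf
  · have h' : (y : ℝ) ≤ x := h
    have h2 : imhAccept γ x y = Real.exp ((γ - 1) * ((y : ℝ) - x)) :=
      min_eq_left (Real.exp_le_one_iff.2
        (mul_nonpos_of_nonneg_of_nonpos (by linarith) (by linarith)))
    rw [imhDensity, h2, max_eq_left h', mul_left_comm, ← Real.exp_add, mul_assoc, ← Real.exp_add]
    ring_nf

/-- The derivative in `a` has size `z * exp (-a * z)`, and `b * z ≤ exp (b * z)` bounds it by `1 /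
b` for all `z`. -/
theorem exp_neg_mul_sub_le {a a' b z : ℝ} (hb : 0 < b) (ha : b ≤ a) (haa : a ≤ a') (hz : 0 ≤ z) :
    Real.exp (-a * z) - Real.exp (-a' * z) ≤ (a' - a) / b := by
  have h1 : Real.exp (-a' * z) = Real.exp (-a * z) * Real.exp (-(a' - a) * z) := by
    rw [← Real.exp_add]; ring_nf
  have h2 := Real.add_one_le_exp (-(a' - a) * z)
  have h3 : z * Real.exp (-a * z) ≤ 1 / b := by
    rw [le_div_iff₀ hb]
    have h4 : Real.exp (-a * z) ≤ Real.exp (-(b * z)) := Real.exp_le_exp.2 (by nlinarith)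
    have h5 := Real.add_one_le_exp (b * z)
    have h6 : Real.exp (b * z) * Real.exp (-(b * z)) = 1 := by rw [← Real.exp_add]; simp
    nlinarith [Real.exp_pos (-(b * z)), mul_nonneg hz hb.le]
  have h7 := Real.exp_pos (-a * z)
  calc Real.exp (-a * z) - Real.exp (-a' * z)
      ≤ (a' - a) * (z * Real.exp (-a * z)) := by rw [h1]; nlinarith
    _ ≤ (a' - a) * (1 / b) := mul_le_mul_of_nonneg_left h3 (by linarith)
    _ = _ := by ring

theorem abs_imhDensity_sub_le {γl γu γ γ' : ℝ} (h : 1 < γl) (hγ : γ ∈ Set.Ioo γl γu)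
    (hγ' : γ' ∈ Set.Ioo γl γu) (x y : ℝ≥0) :
    |imhDensity γ' x y - imhDensity γ x y| ≤
      |γ' - γ| * (1 + γu / (γl - 1)) * Real.exp (-(y : ℝ)) := by
  wlog hle : γ ≤ γ' generalizing γ γ'
  · rw [abs_sub_comm, abs_sub_comm γ']
    exact this hγ' hγ (le_of_not_ge hle)
  obtain ⟨h1, h2⟩ := hγ
  obtain ⟨h1', h2'⟩ := hγ'
  rw [imhDensity_eq (by linarith), imhDensity_eq (by linarith), ← sub_mul, abs_mul,
    abs_of_pos (Real.exp_pos (-(y : ℝ))), abs_of_nonneg (sub_nonneg.2 hle)]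
  refine mul_le_mul_of_nonneg_right ?_ (Real.exp_nonneg _)
  set z := max (x : ℝ) y
  have hz : 0 ≤ z := x.2.trans (le_max_left _ _)
  have h3 := exp_neg_mul_sub_le (a := γ - 1) (a' := γ' - 1) (b := γl - 1) (by linarith)
    (by linarith) (by linarith) hz
  have h4 : Real.exp (-(γ' - 1) * z) ≤ Real.exp (-(γ - 1) * z) := Real.exp_le_exp.2 (by nlinarith)
  have h5 : Real.exp (-(γ' - 1) * z) ≤ 1 := Real.exp_le_one_iff.2 (by nlinarith)
  have h6 := Real.exp_pos (-(γ' - 1) * z)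
  have h7 : γ * (Real.exp (-(γ - 1) * z) - Real.exp (-(γ' - 1) * z)) ≤
      γu * ((γ' - γ) / (γl - 1)) :=
    mul_le_mul h2.le (h3.trans (le_of_eq (by ring))) (by linarith) (by linarith)
  have h8 : γu * ((γ' - γ) / (γl - 1)) = (γ' - γ) * (γu / (γl - 1)) := by ring
  have h9 : 0 ≤ (γ' - γ) * (γu / (γl - 1)) :=
    mul_nonneg (by linarith) (div_nonneg (by linarith) (by linarith))
  rw [abs_le]
  constructor <;> nlinarith

theorem measurableSet_offDiag_nnreal : MeasurableSet {z : ℝ≥0 × ℝ≥0 | z.1 ≠ z.2} :=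
  (measurableSet_eq_fun measurable_fst measurable_snd).compl

theorem tvDist_imhMeasure_le {γl γu γ γ' : ℝ} (h : 1 < γl) (hγ : γ ∈ Set.Ioo γl γu)
    (hγ' : γ' ∈ Set.Ioo γl γu) (x : ℝ≥0) :
    tvDist (imhMeasure γ' x) (imhMeasure γ x) ≤ 2 * (1 + γu / (γl - 1)) * |γ' - γ| := by
  have hp : 0 < γ := by linarith [hγ.1]
  have hp' : 0 < γ' := by linarith [hγ'.1]
  have := isProbabilityMeasure_imhMeasure hp x
  have := isProbabilityMeasure_imhMeasure hp' x
  have hM : 0 ≤ 1 + γu / (γl - 1) :=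
    add_nonneg zero_le_one (div_nonneg (by linarith [hγ.1, hγ.2]) (by linarith))
  set e : ℝ := |γ' - γ| * (1 + γu / (γl - 1)) with he
  have he0 : 0 ≤ e := mul_nonneg (abs_nonneg _) hM
  have hE : ∫⁻ y, ENNReal.ofReal (e * Real.exp (-(y : ℝ))) ∂lebNN = ENNReal.ofReal e := by
    simpa using lintegral_const_mul_exp_lebNN one_pos he0
  have hpt : ∀ {g g' : ℝ}, g ∈ Set.Ioo γl γu → g' ∈ Set.Ioo γl γu → |g' - g| = |γ' - γ| → ∀ y,
      ENNReal.ofReal (imhDensity g' x y) ≤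
        ENNReal.ofReal (imhDensity g x y) + ENNReal.ofReal (e * Real.exp (-(y : ℝ))) := by
    intro g g' hg hg' habs y
    rw [← ENNReal.ofReal_add (imhDensity_nonneg (by linarith [hg.1]) x y) (by positivity)]
    refine ENNReal.ofReal_le_ofReal ?_
    have := (abs_le.1 (abs_imhDensity_sub_le h hg hg' x y)).2
    rw [habs] at this
    linarith
  have hem : Measurable fun y : ℝ≥0 => ENNReal.ofReal (e * Real.exp (-(y : ℝ))) := by fun_prop
  -- The rejection probability complements the density mass, so it moves by at most `e` too. The
  -- density and the atom at `x` each cost `e`, which explains the factor `2`.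
  have hrej : ENNReal.ofReal (imhReject γ' x) ≤ ENNReal.ofReal (imhReject γ x) + ENNReal.ofReal e := by
    have h1 := lintegral_imhDensity_add_reject hp x
    have h2 := lintegral_imhDensity_add_reject hp' x
    have h3 : ∫⁻ y, ENNReal.ofReal (imhDensity γ x y) ∂lebNN ≤
        ∫⁻ y, ENNReal.ofReal (imhDensity γ' x y) ∂lebNN + ENNReal.ofReal e := by
      rw [← hE, ← lintegral_add_right _ hem]
      exact lintegral_mono (hpt hγ' hγ (abs_sub_comm _ _))
    refine (ENNReal.add_le_add_iff_left
      (((lintegral_imhDensity_le hp' x).trans_lt ENNReal.one_lt_top).ne)).1 ?_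
    rw [h2, ← h1]
    refine (add_le_add_left h3 _).trans (le_of_eq ?_)
    ring
  refine tvDist_le_of_forall_measure_le _ _ measurableSet_offDiag_nnreal
    (by positivity) fun s hs => ?_
  have hsum : ENNReal.ofReal (2 * (1 + γu / (γl - 1)) * |γ' - γ|) =
      ENNReal.ofReal e + ENNReal.ofReal e := by
    rw [← ENNReal.ofReal_add he0 he0, he]; ring_nf
  rw [hsum, imhMeasure, imhMeasure, Measure.add_apply, Measure.add_apply, Measure.smul_apply,
    Measure.smul_apply, withDensity_apply _ hs, withDensity_apply _ hs, smul_eq_mul, smul_eq_mul]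
  have hA : ∫⁻ y in s, ENNReal.ofReal (imhDensity γ' x y) ∂lebNN ≤
      ∫⁻ y in s, ENNReal.ofReal (imhDensity γ x y) ∂lebNN + ENNReal.ofReal e := by
    calc _ ≤ ∫⁻ y in s, (ENNReal.ofReal (imhDensity γ x y) +
          ENNReal.ofReal (e * Real.exp (-(y : ℝ)))) ∂lebNN := lintegral_mono (hpt hγ hγ' rfl)
      _ = ∫⁻ y in s, ENNReal.ofReal (imhDensity γ x y) ∂lebNN +
          ∫⁻ y in s, ENNReal.ofReal (e * Real.exp (-(y : ℝ))) ∂lebNN := lintegral_add_right _ hem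
      _ ≤ _ := by
          rw [← hE]
          exact add_le_add le_rfl (setLIntegral_le_lintegral _ _)
  have hB : ENNReal.ofReal (imhReject γ' x) * Measure.dirac x s ≤
      ENNReal.ofReal (imhReject γ x) * Measure.dirac x s + ENNReal.ofReal e := by
    calc _ ≤ (ENNReal.ofReal (imhReject γ x) + ENNReal.ofReal e) * Measure.dirac x s := by gcongr
      _ ≤ _ := by
          rw [add_mul]
          gcongr
          exact mul_le_of_le_one_right zero_le prob_le_one
  refine (add_le_add hA hB).trans (le_of_eq ?_)
  ring

/-! ### The explicit bounds -/

theorem tvDist_nonneg {S : Type*} [MeasurableSpace S] (μ ν : Measure S) : 0 ≤ tvDist μ ν := by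
  refine Real.sInf_nonneg ?_
  rintro _ ⟨ξ, -, rfl⟩
  exact measureReal_nonneg

instance {Y S : Type*} [MeasurableSpace Y] [MeasurableSpace S] (Q : AdaptationPlan Y S)
    (P : Kernel (Y × S) S) [IsMarkovKernel P] (γ₀ : Y) (x₀ : S) (n : ℕ) :
    IsProbabilityMeasure (adaptiveMarginal Q P γ₀ x₀ n) :=
  Measure.isProbabilityMeasure_map
    (show Measurable fun ω : ℕ → Y × S => (ω n).2 by fun_prop).aemeasurable

/-- The chain reaches `(b, ∞)` only by an accepted proposal, which has the lighter tail. -/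
theorem exp_sub_le_tvDist_adaptiveMarginal {γl γu : ℝ} (h : 1 < γl) (γ₀ : Set.Ioo γl γu)
    (Q : AdaptationPlan (Set.Ioo γl γu) ℝ≥0) (n : ℕ) {b : ℝ} (hb : 0 ≤ b) :
    Real.exp (-b) - n * Real.exp (-γl * b) ≤
      tvDist (adaptiveMarginal Q (imhKernel γl γu h) γ₀ 0 n) expTarget := by
  have hm : MeasurableSet {y : ℝ≥0 | b < y} := measurableSet_lt measurable_const (by fun_prop)
  have hf : Measurable ({y : ℝ≥0 | b < y}.indicator (1 : ℝ≥0 → ℝ≥0∞)) := measurable_one.indicator hm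
  have hdrift := lintegral_adaptiveLaw_le_of_drift Q (imhKernel γl γu h) γ₀ 0 hf
    (K := ENNReal.ofReal (Real.exp (-γl * b))) (fun γ x => by
      refine (lintegral_indicator_imhMeasure_le (by linarith [γ.2.1]) hb x).trans ?_
      gcongr
      exact γ.2.1.le) n
  have hmarg : adaptiveMarginal Q (imhKernel γl γu h) γ₀ 0 n {y : ℝ≥0 | b < y} ≤
      ENNReal.ofReal (n * Real.exp (-γl * b)) := by
    rw [adaptiveMarginal, ← lintegral_indicator_one hm, lintegral_map hf (by fun_prop)]
    refine hdrift.trans (le_of_eq ?_)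
    rw [Set.indicator_of_notMem (by simpa using hb), zero_add,
      ENNReal.ofReal_mul (Nat.cast_nonneg n), ENNReal.ofReal_natCast]
  have htv := measure_le_add_tvDist expTarget (adaptiveMarginal Q (imhKernel γl γu h) γ₀ 0 n) hm
  rw [expTarget_tail hb, tvDist_comm _ _ measurableSet_offDiag_nnreal] at htv
  have h1 := htv.trans (add_le_add_left hmarg _)
  rw [← ENNReal.ofReal_add (by positivity) (tvDist_nonneg _ _),
    ENNReal.ofReal_le_ofReal_iff (add_nonneg (by positivity) (tvDist_nonneg _ _))] at h1
  linarith

theorem imhLower_le_tvDist_adaptiveMarginal {γl γu : ℝ} (h : 1 < γl) (γ₀ : Set.Ioo γl γu)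
    (Q : AdaptationPlan (Set.Ioo γl γu) ℝ≥0) (n : ℕ) :
    imhLower γl γu n ≤ tvDist (adaptiveMarginal Q (imhKernel γl γu h) γ₀ 0 n) expTarget := by
  have hlu : γl < γu := γ₀.2.1.trans γ₀.2.2
  have hl : 0 < γl - 1 := by linarith
  set N : ℝ := (γu / (γl - 1) + γu - 1) * n + 1 with hN
  have hc : 1 ≤ γu / (γl - 1) + γu - 1 := by
    have : 1 ≤ γu / (γl - 1) := by rw [le_div_iff₀ hl]; linarith
    linarith
  have hnN : (n : ℝ) ≤ N := by
    have := mul_le_mul_of_nonneg_right hc (Nat.cast_nonneg (α := ℝ) n)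
    linarith
  have hN1 : 1 ≤ N := by
    have : 0 ≤ (γu / (γl - 1) + γu - 1) * n := mul_nonneg (by linarith) (Nat.cast_nonneg _)
    linarith
  have hN0 : 0 < N := by linarith
  have hγ0 : 0 < γl := by linarith
  -- The maximiser of `exp (-b) - N * exp (-γl * b)`, that is, the solution of `exp ((γl - 1) * b) =
  -- N * γl`. Using `N ≥ n` in place of `n` is allowed, and `N ≥ 1` makes `b` nonnegative.
  set b : ℝ := (Real.log N + Real.log γl) / (γl - 1) with hb
  have hb0 : 0 ≤ b :=
    div_nonneg (add_nonneg (Real.log_nonneg hN1) (Real.log_nonneg h.le)) hl.le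
  refine le_trans ?_ (exp_sub_le_tvDist_adaptiveMarginal h γ₀ Q n hb0)
  have h1 : imhLower γl γu n = Real.exp (-b) - N * Real.exp (-γl * b) := by
    change (γl ^ (-1 / (γl - 1)) - γl ^ (-γl / (γl - 1))) / N ^ (1 / (γl - 1)) = _
    rw [Real.rpow_def_of_pos hγ0, Real.rpow_def_of_pos hγ0, Real.rpow_def_of_pos hN0, div_eq_mul_inv,
      ← Real.exp_neg, sub_mul, ← Real.exp_add, ← Real.exp_add]
    have h2 : N * Real.exp (-γl * b) = Real.exp (Real.log N + -γl * b) := by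
      rw [Real.exp_add, Real.exp_log hN0]
    rw [h2, hb]
    congr 2 <;> field_simp <;> ring
  rw [h1]
  have := mul_le_mul_of_nonneg_right hnN (Real.exp_nonneg (-γl * b))
  linarith

/-- Pure comparison of constants: the numerator of `imhUpper` dominates `1 + T * K + 1 / ε`, and
dividing `t` by `m ≥ 1` only lowers the denominator. -/
theorem le_imhUpper {γl γu ε : ℝ} (hγl : 1 < γl) (hγ : γl < γu) (hε0 : 0 < ε)
    (hγε : γu < 2 - ε) (T t : ℕ) :
    (1 + (γu - 1) / (1 - ε) * t) ^ (-((1 - ε) / (γu - 1))) *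
      (1 + T * (γu / (γl - 1 + ε)) + 1 / ε) ≤ imhUpper γl γu ε T t := by
  have hu : 0 < γu - 1 := by linarith
  have he : 0 < 1 - ε := by linarith
  have hl : 0 < γl - 1 + ε := by linarith
  unfold imhUpper
  set c := (γu - 1) / (1 - ε) with hc
  set K := γu / (γl - 1 + ε) with hK
  set w := (1 - ε) / (γu - 1) with hw
  have hc0 : 0 < c := div_pos hu he
  have hw0 : 0 < w := div_pos he hu
  have hK1 : 1 ≤ K := by rw [hK, le_div_iff₀ hl]; linarith
  set α := γl / (2 * K) ^ c with hα
  have hpow : 1 ≤ (2 * K) ^ c := Real.one_le_rpow (by linarith) hc0.le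
  have hα0 : 0 ≤ α := div_nonneg (by linarith) (by linarith)
  have hα2 : α ≤ 2 := by rw [hα, div_le_iff₀ (by linarith)]; linarith
  -- `Real.log` depends on the absolute value only, so `0 ≤ α ≤ 2` suffices. If the logarithm is
  -- zero, the quotient in `m` is zero and `m = 1`.
  have hlogα : Real.log (1 - α) ≤ 0 := by
    rw [← Real.log_abs]
    exact Real.log_nonpos (abs_nonneg _) (abs_le.2 ⟨by linarith, by linarith⟩)
  have hct : 0 ≤ c * t := by positivity
  set m := -Real.log (1 + c * t) / Real.log (1 - α) + 1 with hm
  have hm1 : 1 ≤ m := by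
    have : 0 ≤ -Real.log (1 + c * t) / Real.log (1 - α) :=
      div_nonneg_of_nonpos (by linarith [Real.log_nonneg (show 1 ≤ 1 + c * (t : ℝ) by linarith)]) hlogα
    linarith
  set r := (c + 1) ^ ((2 - ε - γu) / (γu - 1)) with hr
  have hr0 : 0 ≤ r := by positivity
  set R := (4 * K) ^ ((1 - ε) / (2 - ε - γu)) with hR
  have hR0 : 0 ≤ R := by positivity
  have hbase : 0 < 1 + c * (t / m) := by positivity
  have hden : (1 + c * (t / m)) ^ w ≤ (1 + c * t) ^ w := by
    refine Real.rpow_le_rpow hbase.le ?_ hw0.le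
    gcongr
    exact div_le_self (Nat.cast_nonneg t) hm1
  have hnum : 1 + T * K + 1 / ε ≤ 2 * (r + 1) * K * T +
      (1 + 2 * (r + 1) * (1 + ε⁻¹) + (r + 1) * (R + r * (R + 4 * K))) := by
    have h1 : 0 ≤ (r + 1) * (R + r * (R + 4 * K)) := by positivity
    have h2 : 0 ≤ r * K * T := by positivity
    have h3 : 0 ≤ K * T := by positivity
    have h4 : 0 < ε⁻¹ := inv_pos.2 hε0
    have h5 : 0 ≤ r * ε⁻¹ := by positivity
    rw [one_div]
    nlinarith
  rw [Real.rpow_neg (by positivity), mul_comm, ← div_eq_mul_inv]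
  change _ ≤ _ / (1 + c * (t / m)) ^ w
  exact div_le_div₀ (le_trans (by positivity) hnum) hnum (Real.rpow_pos_of_pos hbase _) hden

/-- With `L` the Lipschitz constant, it is enough that the normalised increments stay below `J / L`
from `s` on. The failure events `B s` decrease in `s` to a null set, so continuity from above makes
one of them small. They involve the parameters only and are therefore measurable. -/
theorem exists_isDiminishingTime_imhKernel {γl γu ρ δ : ℝ} (h : 1 < γl) (hρ : 0 < ρ) (hδ : 0 < δ)
    {G : ℕ → ℝ} (hGpos : ∀ n, 0 < G n) (μ : Measure (ℕ → Set.Ioo γl γu × ℝ≥0))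
    [IsProbabilityMeasure μ]
    (hdim : ∀ᵐ ω ∂μ,
      Tendsto (fun t : ℕ => |((ω (t + 1)).1 : ℝ) - (ω t).1| / G t) atTop (𝓝 0)) :
    ∃ s : ℕ, IsDiminishingTime (imhKernel γl γu h) μ (fun n => imhJ γl ρ * G n) δ s := by
  obtain ⟨ω₀⟩ : Nonempty (ℕ → Set.Ioo γl γu × ℝ≥0) := μ.nonempty_of_neZero
  have hlu : γl < γu := (ω₀ 0).1.2.1.trans (ω₀ 0).1.2.2
  set L : ℝ := 2 * (1 + γu / (γl - 1)) with hL
  have hL0 : 0 < L := by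
    have : 0 < γu / (γl - 1) := div_pos (by linarith) (by linarith)
    positivity
  have hJ : 0 < imhJ γl ρ := by
    have : 0 < γl := by linarith
    unfold imhJ; positivity
  set B : ℕ → Set (ℕ → Set.Ioo γl γu × ℝ≥0) := fun s =>
    ⋃ n, ⋃ (_ : s ≤ n), {ω | imhJ γl ρ / L < |((ω (n + 1)).1 : ℝ) - (ω n).1| / G n} with hB
  have hBm : ∀ s, MeasurableSet (B s) := fun s =>
    MeasurableSet.iUnion fun n => MeasurableSet.iUnion fun _ =>
      measurableSet_lt measurable_const (by fun_prop)
  have hBanti : Antitone B := fun s s' hss => by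
    refine Set.iUnion_mono fun n => Set.iUnion_subset fun hn => ?_
    exact Set.subset_iUnion_of_subset (hss.trans hn) subset_rfl
  have hB0 : μ (⋂ s, B s) = 0 := by
    refine measure_mono_null (fun ω hω => ?_) hdim
    intro hlim
    obtain ⟨s, hs⟩ := eventually_atTop.1 (hlim.eventually_lt_const (div_pos hJ hL0))
    have h1 := Set.mem_iInter.1 hω s
    simp only [hB, Set.mem_iUnion] at h1
    obtain ⟨n, hn, h2⟩ := h1
    exact lt_asymm h2 (hs n hn)
  have htend := tendsto_measure_iInter_atTop (μ := μ) (fun s => (hBm s).nullMeasurableSet) hBanti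
    ⟨0, measure_ne_top μ _⟩
  rw [hB0] at htend
  obtain ⟨s, hs⟩ := (htend.eventually_lt_const (ENNReal.ofReal_pos.2 hδ)).exists
  refine ⟨s, ?_⟩
  refine (ENNReal.toReal_mono (measure_ne_top μ _) (measure_mono ?_)).trans
    (ENNReal.toReal_le_of_le_ofReal hδ.le hs.le)
  intro ω hω
  by_contra hnB
  refine hω fun n hn x => ?_
  have h1 : |((ω (n + 1)).1 : ℝ) - (ω n).1| / G n ≤ imhJ γl ρ / L := by
    by_contra hlt
    exact hnB (Set.mem_iUnion₂.2 ⟨n, hn, not_le.1 hlt⟩)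
  rw [div_le_iff₀ (hGpos n)] at h1
  calc tvDist (imhMeasure (ω (n + 1)).1 x) (imhMeasure (ω n).1 x)
      ≤ L * |((ω (n + 1)).1 : ℝ) - (ω n).1| :=
        tvDist_imhMeasure_le h (ω n).1.2 (ω (n + 1)).1.2 x
    _ ≤ L * (imhJ γl ρ / L * G n) := by gcongr
    _ = imhJ γl ρ * G n := by field_simp

/-! ### Choice of the freezing time and assembly of the upper bound -/

theorem le_one_div_invRecip {G : ℕ → ℝ} (hGpos : ∀ n, 0 < G n) (hGlim : Tendsto G atTop (𝓝 0))
    (y : ℝ) : y ≤ 1 / G (invRecip G y) := by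
  have hne : {n : ℕ | y ≤ 1 / G n}.Nonempty := by
    have h1 : Tendsto G atTop (𝓝[>] 0) :=
      tendsto_nhdsWithin_iff.2 ⟨hGlim, Eventually.of_forall hGpos⟩
    obtain ⟨n, hn⟩ := (h1.inv_tendsto_nhdsGT_zero.eventually_ge_atTop y).exists
    exact ⟨n, by simpa using hn⟩
  exact Nat.sInf_mem hne

theorem sum_range_natCast_le (t : ℕ) : ∑ k ∈ Finset.range t, (k : ℝ) ≤ (t : ℝ) ^ 2 / 2 := by
  induction t with
  | zero => simp
  | succ t ih =>
    rw [Finset.sum_range_succ]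
    push_cast
    nlinarith

theorem tvDist_adaptiveMarginal_le_imhUpper {γl γu ε δ g : ℝ} (h : 1 < γl) (hε0 : 0 < ε)
    (hγε : γu < 2 - ε) (hδ : 0 < δ) (hg0 : 0 ≤ g) (γ₀ : Set.Ioo γl γu)
    (Q : AdaptationPlan (Set.Ioo γl γu) ℝ≥0) {d : ℕ → ℝ} {s T t : ℕ}
    (hs : IsDiminishingTime (imhKernel γl γu h) (adaptiveLaw Q (imhKernel γl γu h) γ₀ 0) d (δ / 2) s)
    (hT : s ≤ T) (hg : ∀ n, T ≤ n → d n ≤ g) (hgt : g * t ^ 2 ≤ δ) :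
    tvDist (adaptiveMarginal Q (imhKernel γl γu h) γ₀ 0 (T + t)) expTarget ≤
      imhUpper γl γu ε T t + δ := by
  have hlu : γl < γu := γ₀.2.1.trans γ₀.2.2
  have hε1 : ε < 1 := by linarith
  set K := γu / (γl - 1 + ε) with hK
  have hK0 : 0 ≤ K := div_nonneg (by linarith) (by linarith)
  set B : ℝ := (1 + (γu - 1) / (1 - ε) * t) ^ (-((1 - ε) / (γu - 1))) with hB
  have hB0 : 0 ≤ B := Real.rpow_nonneg (add_nonneg zero_le_one (mul_nonneg
    (div_nonneg (by linarith) (by linarith)) (Nat.cast_nonneg t))) _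
  have hup := le_imhUpper h hlu hε0 hγε T t
  have hmain : 0 ≤ B * (1 + T * K + 1 / ε) := by positivity
  set μ := adaptiveLaw Q (imhKernel γl γu h) γ₀ 0 with hμ
  have hV : Measurable fun x : ℝ≥0 => ENNReal.ofReal (Real.exp ((1 - ε) * (x : ℝ))) := by fun_prop
  have hdrift : ∫⁻ ω, ENNReal.ofReal (Real.exp ((1 - ε) * ((ω T).2 : ℝ))) ∂μ ≤
      1 + T * ENNReal.ofReal K := by
    refine (lintegral_adaptiveLaw_le_of_drift Q (imhKernel γl γu h) γ₀ 0 hV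
      (K := ENNReal.ofReal K) (fun γ x => ?_) T).trans (by simp)
    obtain ⟨h1, h2⟩ := γ.2
    refine (lintegral_exp_imhMeasure_le (by linarith) (by linarith) x).trans ?_
    gcongr
    exact div_le_div₀ (by linarith) h2.le (by linarith) (by linarith)
  refine tvDist_le_of_forall_measure_le _ _ measurableSet_offDiag_nnreal (by linarith)
    fun A hA => ?_
  have hsum : ∑ k ∈ Finset.range t, (k : ℝ≥0∞) * ENNReal.ofReal g ≤ ENNReal.ofReal (δ / 2) := by
    calc ∑ k ∈ Finset.range t, (k : ℝ≥0∞) * ENNReal.ofReal g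
        = ∑ k ∈ Finset.range t, ENNReal.ofReal (k * g) := by
          refine Finset.sum_congr rfl fun k _ => ?_
          rw [ENNReal.ofReal_mul (Nat.cast_nonneg k), ENNReal.ofReal_natCast]
      _ = ENNReal.ofReal (∑ k ∈ Finset.range t, k * g) :=
          (ENNReal.ofReal_sum_of_nonneg fun k _ => by positivity).symm
      _ ≤ _ := by
          refine ENNReal.ofReal_le_ofReal ?_
          rw [← Finset.sum_mul]
          nlinarith [mul_le_mul_of_nonneg_right (sum_range_natCast_le t) hg0]
  -- The fixed-parameter rate is applied pathwise, with the random frozen parameter; it is uniform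
  -- in the parameter, so only the mean of `exp ((1 - ε) * X T)` is needed.
  have hiter : ∫⁻ ω, iterMean (imhKernel γl γu h) (A.indicator 1) t ((ω (T + 1)).1, (ω T).2) ∂μ ≤
      expTarget A + ENNReal.ofReal (B * (1 + T * K + 1 / ε)) := by
    calc _ ≤ ∫⁻ ω, (expTarget A + ENNReal.ofReal B *
            (ENNReal.ofReal (Real.exp ((1 - ε) * ((ω T).2 : ℝ))) + ENNReal.ofReal (1 / ε))) ∂μ :=
          lintegral_mono fun ω => iterMean_imhKernel_le_rate h hε0 hε1 _ hA t _
      _ = expTarget A + ENNReal.ofReal B *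
            (∫⁻ ω, ENNReal.ofReal (Real.exp ((1 - ε) * ((ω T).2 : ℝ))) ∂μ +
              ENNReal.ofReal (1 / ε)) := by
          rw [lintegral_add_left measurable_const, lintegral_const_mul _ (by fun_prop),
            lintegral_add_right _ measurable_const]
          simp
      _ ≤ expTarget A + ENNReal.ofReal B * (1 + T * ENNReal.ofReal K + ENNReal.ofReal (1 / ε)) := by
          gcongr
      _ = _ := by
          rw [ENNReal.ofReal_mul hB0, ENNReal.ofReal_add (by positivity) (by positivity),
            ENNReal.ofReal_add zero_le_one (by positivity),
            ENNReal.ofReal_mul (Nat.cast_nonneg T), ENNReal.ofReal_natCast, ENNReal.ofReal_one]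
  calc adaptiveMarginal Q (imhKernel γl γu h) γ₀ 0 (T + t) A
      ≤ expTarget A + ENNReal.ofReal (B * (1 + T * K + 1 / ε)) + ENNReal.ofReal (δ / 2) +
          ENNReal.ofReal (δ / 2) :=
        (adaptiveMarginal_le_iterMean Q _ γ₀ 0 hs hT hg t hA).trans
          (add_le_add (add_le_add hiter hsum) le_rfl)
    _ = expTarget A + ENNReal.ofReal (B * (1 + T * K + 1 / ε) + δ) := by
        rw [add_assoc, ← ENNReal.ofReal_add (by positivity) (by positivity), add_halves, add_assoc,
          ENNReal.ofReal_add hmain hδ.le]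
    _ ≤ _ := by gcongr

theorem proposition5p2 (γl γu ε ρ δ : ℝ) (hγl : 1 < γl) (hγ : γl < γu)
    (hε : ε ∈ Set.Ioo (0 : ℝ) 1) (hγε : γu < 2 - ε) (hρ : 0 < ρ) (hδ : δ ∈ Set.Ioo (0 : ℝ) 1)
    (G : ℕ → ℝ) (hGpos : ∀ n, 0 < G n) (hGanti : StrictAnti G) (hGlim : Tendsto G atTop (𝓝 0))
    (γ₀ : Set.Ioo γl γu) (Q : AdaptationPlan (Set.Ioo γl γu) ℝ≥0)
    -- the transition kernel is not changed while the chain is beyond the level `ρ`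
    (hfreeze : ∀ᵐ ω ∂adaptiveLaw Q (imhKernel γl γu hγl) γ₀ 0, ∀ t : ℕ, ρ ≤ ((ω t).2 : ℝ) →
      imhKernel γl γu hγl ((ω (t + 1)).1, (ω t).2) = imhKernel γl γu hγl ((ω t).1, (ω t).2))
    (hdim : ∀ᵐ ω ∂adaptiveLaw Q (imhKernel γl γu hγl) γ₀ 0,
      Tendsto (fun t : ℕ => |((ω (t + 1)).1 : ℝ) - (ω t).1| / G t) atTop (𝓝 0)) :
    -- there is an admissible time `s`, and every admissible `s` gives the two bounds at all times
    (∃ s : ℕ, IsDiminishingTime (imhKernel γl γu hγl)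
      (adaptiveLaw Q (imhKernel γl γu hγl) γ₀ 0) (fun n => imhJ γl ρ * G n) (δ / 2) s) ∧
    ∀ s : ℕ, IsDiminishingTime (imhKernel γl γu hγl)
      (adaptiveLaw Q (imhKernel γl γu hγl) γ₀ 0) (fun n => imhJ γl ρ * G n) (δ / 2) s →
    ∀ t T : ℕ, T = s + invRecip G (imhJ γl ρ * t ^ 2 / δ) →
      imhLower γl γu (T + t) ≤
        tvDist (adaptiveMarginal Q (imhKernel γl γu hγl) γ₀ 0 (T + t)) expTarget ∧
      tvDist (adaptiveMarginal Q (imhKernel γl γu hγl) γ₀ 0 (T + t)) expTarget ≤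
        imhUpper γl γu ε T t + δ := by

  have hJ : 0 < imhJ γl ρ := by
    have : 0 < γl := by linarith
    unfold imhJ; positivity
  refine ⟨exists_isDiminishingTime_imhKernel hγl hρ (half_pos hδ.1) hGpos _ hdim, ?_⟩
  rintro s hs t T rfl
  refine ⟨imhLower_le_tvDist_adaptiveMarginal hγl γ₀ Q _, ?_⟩
  set N := invRecip G (imhJ γl ρ * t ^ 2 / δ) with hN
  -- `G` decreases, so `J * G N` bounds the kernel increments at all times from `s + N` on. The
  -- definition of `N` says exactly that `1 / G N ≥ J * t ^ 2 / δ`, hence `g * t ^ 2 ≤ δ`.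
  refine tvDist_adaptiveMarginal_le_imhUpper (g := imhJ γl ρ * G N) hγl hε.1 hγε hδ.1
    (mul_pos hJ (hGpos N)).le γ₀ Q hs (Nat.le_add_right _ _)
    (fun n hn => mul_le_mul_of_nonneg_left (hGanti.antitone (by omega)) hJ.le) ?_
  have h1 := le_one_div_invRecip hGpos hGlim (imhJ γl ρ * t ^ 2 / δ)
  rw [← hN, div_le_div_iff₀ hδ.1 (hGpos N)] at h1
  linarith
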